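/- An instance $\mathcal I=(I,w,v,m,k)$ of CMK consists of a finite set of items $I$, weights $w:I\to[0,1]$, values $v:I\to\mathbb R_{\ge 0}$, a number of bins $m\in\mathbb N_{>0}$ and a cardinality bound $k\in\mathbb N_{>0}$. A configuration is a set $C\subseteq I$ with $|C|\le k$ and $\sum_{i\in C}w(i)\le 1$; let $\mathcal C$ be the set of configurations. For $B\subseteq I$ put $v(B)=\sum_{i\in B}v(i)$, and let $\mathrm{OPT}(\mathcal I)$ be the maximum of $v(C_1\cup\dots\cup C_m)$ over $(C_1,\dots,C_m)\in\mathcal C^m$. For $x\in\mathbb R_{\ge 0}^{\mathcal C}$ let $\mathrm{cover}_i(x)=\sum_{C\in\mathcal C,\,i\in C}x_C$, $\|x\|=\sum_{C\in\mathcal C}x_C$ and $v(x)=\sum_{i\in I}v(i)\,\mathrm{cover}_i(x)$. For $S\subseteq I$ and $\ell\in\mathbb N$, $\mathrm{LP}(S,\ell)$ asks to maximize $v(x)$ over all $x\in\mathbb R_{\ge 0}^{\mathcal C}$ with $\mathrm{cover}_i(x)\le 1$ for all $i\in I$, with $x_C=0$ unless $C\subseteq S$, and with $\|x\|=\ell$;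 a $(1-\varepsilon)$-approximate solution is a feasible $x$ whose value is at least $(1-\varepsilon)$ times the maximum. Let $\varepsilon\in(0,0.1)$ with $\varepsilon^{-1/2}\in\mathbb N$, and let $\mathcal I$ be an $\varepsilon$-simple CMK instance, that is, $m>\exp(\exp(\varepsilon^{-30}))$ and $\varepsilon m\in\mathbb N$. Iterative randomized rounding starts with $S_0=I$ and, for $j=1,\dots,\varepsilon^{-1}$, takes a $(1-\varepsilon)$-approximate solution $x^j$ of $\mathrm{LP}(S_{j-1},m(1-(j-1)\varepsilon))$, which may be chosen arbitrarily as a function of the configurations sampled in iterations $1,\dots,j-1$; samples $q=\varepsilon m$ configurations $R^j_1,\dots,R^j_q$ that, given the previous iterations, are independent with $\Pr(R^j_b=C)=x^j_C/\|x^j\|$ for all $C\in\mathcal C$; and sets $S_j=S_{j-1}\setminus\bigcup_{b=1}^{q}R^j_b$. Let $V=v\bigl(\bigcup_{j=1}^{\varepsilon^{-1}}\bigcup_{b=1}^{q}R^j_b\bigr)$ be the value of the returned solution. Then, for every such choice of the solutions $x^j$, $$\mathbb E[V]\;\ge\;\bigl(1-300\,\varepsilon^{1/2}\bigr)\cdot\mathrm{OPT}(\mathcal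 I).$$ -/

import Mathlib

open scoped NNReal ENNReal

/-- An instance `(I, w, v, m, k)` of Uniform Cardinality Constrained Multiple Knapsack (CMK)
whose set of items is the finite type `I`. -/
structure CMK (I : Type*) where
  /-- the weight function -/
  w : I → ℝ
  /-- the value function -/
  v : I → ℝ
  /-- the number of bins -/
  m : ℕ
  /-- the cardinality constraint -/
  k : ℕ
  w_nonneg : ∀ i, 0 ≤ w i
  w_le_one : ∀ i, w i ≤ 1
  v_nonneg : ∀ i, 0 ≤ v i
  m_pos : 0 < m
  k_pos : 0 < k

namespace CMK

variable {I : Type*} [Fintype I] [DecidableEq I]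

/-- A configuration: a set of at most `k` items of total weight at most `1`. -/
def IsConfig (P : CMK I) (C : Finset I) : Prop :=
  C.card ≤ P.k ∧ ∑ i ∈ C, P.w i ≤ 1

/-- The set of all configurations of the instance. -/
abbrev Config (P : CMK I) : Type _ := {C : Finset I // P.IsConfig C}

noncomputable instance instFintypeConfig (P : CMK I) : Fintype P.Config :=
  Fintype.ofFinite _

/-- The empty configuration. -/
def emptyConfig (P : CMK I) : P.Config := ⟨∅, by simp [IsConfig]⟩

instance instNonemptyConfig (P : CMK I) : Nonempty P.Config := ⟨P.emptyConfig⟩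

/-- The value `v(B)` of a set `B` of items. -/
def setValue (P : CMK I) (B : Finset I) : ℝ := ∑ i ∈ B, P.v i

/-- The value of a solution `(C_1, …, C_m)`: every item of the union is counted once. -/
def solutionValue (P : CMK I) (C : Fin P.m → P.Config) : ℝ :=
  P.setValue (Finset.univ.biUnion fun b => (C b).1)

/-- `OPT`, the largest value of a solution (there are finitely many solutions). -/
noncomputable def opt (P : CMK I) : ℝ := ⨆ C : Fin P.m → P.Config, P.solutionValue C

theorem opt_isGreatest (P : CMK I) : IsGreatest (Set.range P.solutionValue) P.opt := by
  obtain ⟨C, hC⟩ := Finite.exists_max P.solutionValue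
  have h : P.opt = P.solutionValue C :=
    le_antisymm (ciSup_le hC) (le_ciSup (Set.finite_range P.solutionValue).bddAbove C)
  rw [h]
  exact ⟨⟨C, rfl⟩, by rintro _ ⟨D, rfl⟩; exact hC D⟩

/-- `ε`-simple instances. -/
def IsSimple (P : CMK I) (ε : ℝ) : Prop :=
  Real.exp (Real.exp (ε ^ (-30 : ℤ))) < (P.m : ℝ) ∧ ∃ q : ℕ, ε * P.m = q

/-- Fractional solutions: non-negative vectors indexed by the configurations. -/
abbrev FracSol (P : CMK I) : Type _ := P.Config → ℝ≥0

/-- The coverage of the item `i` by a fractional solution. -/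
noncomputable def cover (P : CMK I) (x : P.FracSol) (i : I) : ℝ :=
  ∑ C with i ∈ C.1, (x C : ℝ)

/-- The size `‖x‖` of a fractional solution. -/
noncomputable def size (P : CMK I) (x : P.FracSol) : ℝ := ∑ C, (x C : ℝ)

/-- The value of a fractional solution, that is, the value of its coverage. -/
noncomputable def fracValue (P : CMK I) (x : P.FracSol) : ℝ := ∑ i, P.cover x i * P.v i

/-- `x` satisfies the constraints of the configuration LP with remaining items `S` and `l` bins. -/
def LPFeasible (P : CMK I) (S : Finset I) (l : ℝ) (x : P.FracSol) : Prop :=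
  (∀ i, P.cover x i ≤ 1) ∧ (∀ C, x C ≠ 0 → C.1 ⊆ S) ∧ P.size x = l

/-- `x` is a `(1 - ε)`-approximate solution of the configuration LP: it is feasible and its value
is at least `1 - ε` times the value of every feasible solution, hence of an optimal one. -/
def LPApprox (P : CMK I) (ε : ℝ) (S : Finset I) (l : ℝ) (x : P.FracSol) : Prop :=
  P.LPFeasible S l x ∧ ∀ z, P.LPFeasible S l z → (1 - ε) * P.fracValue z ≤ P.fracValue x

/-- The distribution of a random configuration `R ∼ x`, i.e. `Pr (R = C) = x C / ‖x‖`.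
It is only meaningful for `x ≠ 0`; for `x = 0` the value is a placeholder. -/
noncomputable def configLaw (P : CMK I) (x : P.FracSol) : PMF P.Config :=
  open Classical in
  if hx : ∑' C, (x C : ℝ≥0∞) = 0 then PMF.pure P.emptyConfig
  else PMF.normalize (fun C => (x C : ℝ≥0∞)) hx
    (by rw [tsum_fintype]; exact (ENNReal.sum_lt_top.2 fun _ _ => ENNReal.coe_lt_top).ne)

/-- The joint distribution of `q` independent samples from `p`. -/
noncomputable def iidLaw {α : Type*} [Fintype α] (p : PMF α) (q : ℕ) : PMF (Fin q → α) :=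
  PMF.ofFintype (fun r => ∏ b, p (r b)) (by
    classical
    have h : ∏ _b : Fin q, ∑ a, p a = ∑ r : Fin q → α, ∏ b, p (r b) := by
      rw [Finset.prod_univ_sum, Fintype.piFinset_univ]
    rw [← h, ← tsum_fintype (L := .unconditional _), p.tsum_coe]
    simp)

/-- The samples of the first `j` iterations, with `q` configurations sampled in each:
`h a b` is the `b`-th configuration sampled in the `a`-th iteration (counted from `0`). -/
abbrev History (P : CMK I) (q j : ℕ) : Type _ := Fin j → Fin q → P.Config

/-- The items packed in the first `j` iterations. -/
def packed (P : CMK I) {q j : ℕ} (h : P.History q j) : Finset I :=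
  Finset.univ.biUnion fun a => Finset.univ.biUnion fun b => (h a b).1

/-- The items `S_j` that remain after the first `j` iterations. -/
def remaining (P : CMK I) {q j : ℕ} (h : P.History q j) : Finset I :=
  Finset.univ \ P.packed h

/-- A rule for choosing the LP solution of the next iteration. The choice may depend on all the
configurations sampled so far. -/
abbrev LPRule (P : CMK I) (q : ℕ) : Type _ := (j : ℕ) → P.History q j → P.FracSol

/-- In each of the `N` iterations, after `j < N` completed ones, the rule returns a
`(1 - ε)`-approximate solution of the configuration LP with the remaining items and
the `m * (1 - j * ε)` remaining bins. -/
def LPRule.IsApprox {P : CMK I} {q : ℕ} (X : P.LPRule q) (ε : ℝ) (N : ℕ) : Prop :=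
  ∀ j < N, ∀ h : P.History q j, P.LPApprox ε (P.remaining h) (P.m * (1 - j * ε)) (X j h)

/-- Iterative randomized rounding: the distribution of the samples of the first `j` iterations.
In each iteration `q` configurations are sampled, independently given the past, from the
distribution given by the LP solution that the rule `X` chooses. -/
noncomputable def run (P : CMK I) {q : ℕ} (X : P.LPRule q) : (j : ℕ) → PMF (P.History q j)
  | 0 => PMF.pure Fin.elim0
  | j + 1 => (P.run X j).bind fun h =>
      (iidLaw (P.configLaw (X j h)) q).map fun r => Fin.snoc (α := fun _ => Fin q → P.Config) h r

/-- The number `ε⁻¹` of iterations (the floor is exact whenever `ε⁻¹` is an integer). -/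
noncomputable def numIter (ε : ℝ) : ℕ := ⌊ε⁻¹⌋₊

/-- The number `ε * m` of samples per iteration (the floor is exact for `ε`-simple instances). -/
noncomputable def batch (P : CMK I) (ε : ℝ) : ℕ := ⌊ε * P.m⌋₊

/-- The expected value `E[V]` of the solution returned by iterative randomized rounding with
parameter `ε`, when the LP solutions are chosen by the rule `X`. -/
noncomputable def expectedValue (P : CMK I) (ε : ℝ) (X : P.LPRule (P.batch ε)) : ℝ :=
  ∑ h : P.History (P.batch ε) (numIter ε),
    (P.run X (numIter ε) h).toReal * P.setValue (P.packed h)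

end CMK

/-!
Put `s = ε ^ (-1 / 2)` and `m = q * s ^ 2`, so that an iteration samples `q` configurations.

Every item carries a weight, initially `1`. When an iteration packs an item its weight drops to `0`,
and the weights of the other items are rescaled so that the mean of every weight after `j`
iterations is exactly `1 - j * ε`. If `u ≥ 0` has total at most `τ` on every configuration, then an
iteration increases the variance of the linear functional `u` of the weights by at most `q * τ ^ 2`.
Rounding the weights by independent coins therefore yields a random set `T` of items that are not
yet packed, which contains every item with probability `p = 1 - j * ε` and on which linear
functionals are concentrated.

In an optimal solution, the large items are grouped by weight into blocks of `q` items, and the bins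
are classified by the number of their items in each block. If a number of tests that depends only on
`s` find no more items or weight of the solution in `T` than expected, then the items of the
solution in `T` fit into `p * m + 7 * q` bins: a large item takes a slot of the next heavier block.
By Chebyshev's inequality almost all sets `T` pass the tests, so the linear program of the iteration
has value at least about `(1 - j * ε) * OPT` on average, and the iteration packs items of value
about `ε * OPT`. The loss is small enough until the last `s` of the `s ^ 2` iterations, and those
can be given up.
-/

namespace CMK

section Mean

variable {α β : Type*} [Fintype α] [Fintype β]

/-- The expectation of a real random variable on a finite probability space, as a plain sum. -/
noncomputable def mean (p : PMF α) (f : α → ℝ) : ℝ := ∑ a, (p a).toReal * f a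

theorem sum_toReal_eq_one (p : PMF α) : ∑ a, (p a).toReal = 1 := by
  rw [← ENNReal.toReal_sum fun a _ => p.apply_ne_top a, ← tsum_fintype (L := .unconditional _),
    p.tsum_coe, ENNReal.toReal_one]

theorem mean_const (p : PMF α) (c : ℝ) : mean p (fun _ => c) = c := by
  rw [mean, ← Finset.sum_mul, sum_toReal_eq_one, one_mul]

theorem mean_add (p : PMF α) (f g : α → ℝ) :
    mean p (fun a => f a + g a) = mean p f + mean p g := by
  simp only [mean, mul_add, Finset.sum_add_distrib]

theorem mean_sub (p : PMF α) (f g : α → ℝ) :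
    mean p (fun a => f a - g a) = mean p f - mean p g := by
  simp only [mean, mul_sub, Finset.sum_sub_distrib]

theorem mean_const_mul (p : PMF α) (c : ℝ) (f : α → ℝ) :
    mean p (fun a => c * f a) = c * mean p f := by
  simp only [mean, Finset.mul_sum, mul_left_comm]

theorem mean_sum {ι : Type*} (p : PMF α) (S : Finset ι) (f : ι → α → ℝ) :
    mean p (fun a => ∑ i ∈ S, f i a) = ∑ i ∈ S, mean p (f i) := by
  simp only [mean, Finset.mul_sum]
  exact Finset.sum_comm

theorem mean_mono_of_mem_support {p : PMF α} {f g : α → ℝ} (h : ∀ a ∈ p.support, f a ≤ g a) :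
    mean p f ≤ mean p g := by
  refine Finset.sum_le_sum fun a _ => ?_
  by_cases ha : a ∈ p.support
  · exact mul_le_mul_of_nonneg_left (h a ha) ENNReal.toReal_nonneg
  · simp [(p.apply_eq_zero_iff a).2 ha]

theorem mean_mono {p : PMF α} {f g : α → ℝ} (h : ∀ a, f a ≤ g a) : mean p f ≤ mean p g :=
  mean_mono_of_mem_support fun a _ => h a

theorem mean_nonneg {p : PMF α} {f : α → ℝ} (h : ∀ a, 0 ≤ f a) : 0 ≤ mean p f :=
  (mean_const p 0).symm.le.trans (mean_mono h)

theorem mean_pure (a : α) (f : α → ℝ) : mean (PMF.pure a) f = f a := by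
  classical
  rw [mean, Finset.sum_eq_single a] <;> simp +contextual [PMF.pure_apply]

theorem mean_bind (p : PMF α) (g : α → PMF β) (f : β → ℝ) :
    mean (p.bind g) f = mean p fun a => mean (g a) f := by
  simp only [mean, PMF.bind_apply, tsum_fintype, Finset.mul_sum]
  rw [Finset.sum_comm]
  refine Finset.sum_congr rfl fun b _ => ?_
  rw [ENNReal.toReal_sum fun a _ => ENNReal.mul_ne_top (p.apply_ne_top a) ((g a).apply_ne_top b),
    Finset.sum_mul]
  exact Finset.sum_congr rfl fun a _ => by rw [ENNReal.toReal_mul, mul_assoc]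

theorem mean_map (p : PMF α) (g : α → β) (f : β → ℝ) :
    mean (p.map g) f = mean p fun a => f (g a) := by
  rw [← PMF.bind_pure_comp, mean_bind]
  simp only [Function.comp_apply, mean_pure]

theorem mean_sq_sub_le {p : PMF α} {f : α → ℝ} {v : ℝ}
    (h : mean p (fun a => f a ^ 2) ≤ mean p f ^ 2 + v) (c : ℝ) :
    mean p (fun a => (f a - c) ^ 2) ≤ (mean p f - c) ^ 2 + v := by
  have hexp : ∀ a, (f a - c) ^ 2 = f a ^ 2 - 2 * c * f a + c ^ 2 := fun a => by ring
  simp only [hexp]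
  rw [mean_add, mean_sub, mean_const_mul, mean_const]
  linarith

theorem mean_sq_sum_le {ι : Type*} [Fintype ι] {p : PMF α} {Y : ι → α → ℝ} {μ u : ι → ℝ}
    {c : ι → ι → ℝ} (hu : ∀ i, 0 ≤ u i)
    (h : ∀ i j, mean p (fun a => Y i a * Y j a) ≤ μ i * μ j + c i j) :
    mean p (fun a => (∑ i, u i * Y i a) ^ 2)
      ≤ (∑ i, u i * μ i) ^ 2 + ∑ i, ∑ j, u i * u j * c i j := by
  have hexp : ∀ a, (∑ i, u i * Y i a) ^ 2 = ∑ i, ∑ j, u i * u j * (Y i a * Y j a) := fun a => by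
    simp only [sq, Finset.sum_mul_sum, mul_mul_mul_comm]
  simp only [hexp, mean_sum, mean_const_mul]
  rw [sq, Finset.sum_mul_sum]
  simp only [← Finset.sum_add_distrib]
  refine Finset.sum_le_sum fun i _ => Finset.sum_le_sum fun j _ => ?_
  linarith [mul_le_mul_of_nonneg_left (h i j) (mul_nonneg (hu i) (hu j)),
    mul_mul_mul_comm (u i) (u j) (μ i) (μ j)]

end Mean

theorem mean_iidLaw_prod {α : Type*} [Fintype α] (p : PMF α) (q : ℕ) (g : α → ℝ) :
    mean (iidLaw p q) (fun r => ∏ b, g (r b)) = mean p g ^ q := by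
  classical
  have h : ∏ _b : Fin q, ∑ a, (p a).toReal * g a
      = ∑ r : Fin q → α, ∏ b, ((p (r b)).toReal * g (r b)) := by
    rw [Finset.prod_univ_sum, Fintype.piFinset_univ]
  rw [Finset.prod_const, Finset.card_univ, Fintype.card_fin] at h
  rw [mean, mean, h]
  refine Finset.sum_congr rfl fun r _ => ?_
  rw [iidLaw, PMF.ofFintype_apply, ENNReal.toReal_prod, Finset.prod_mul_distrib]

section Sampling

variable {α I : Type*} [DecidableEq I]

/-- The union of the sets given by `q` samples. -/
def sampled {q : ℕ} (S : α → Finset I) (r : Fin q → α) : Finset I :=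
  Finset.univ.biUnion fun b => S (r b)

/-- The indicator of the event that none of the `q` sampled sets contains `i`. -/
def missed {q : ℕ} (S : α → Finset I) (r : Fin q → α) (i : I) : ℝ :=
  if i ∈ sampled S r then 0 else 1

theorem missed_mem_Icc {q : ℕ} (S : α → Finset I) (r : Fin q → α) (i : I) :
    missed S r i ∈ Set.Icc (0 : ℝ) 1 := by
  unfold missed
  split_ifs <;> simp

theorem missed_eq_prod {q : ℕ} (S : α → Finset I) (r : Fin q → α) (i : I) :
    missed S r i = ∏ b, if i ∈ S (r b) then (0 : ℝ) else 1 := by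
  simp only [missed, sampled, Finset.mem_biUnion, Finset.mem_univ, true_and]
  split_ifs with h
  · obtain ⟨b, hb⟩ := h
    symm
    exact Finset.prod_eq_zero (Finset.mem_univ b) (if_pos hb)
  · exact (Finset.prod_eq_one fun b _ => if_neg fun hb => h ⟨b, hb⟩).symm

variable [Fintype α] {p : PMF α} {S : α → Finset I}

/-- The probability that a random set, drawn from the family `S` according to `p`, contains `i`. -/
noncomputable def inclProb (p : PMF α) (S : α → Finset I) (i : I) : ℝ :=
  mean p fun a => if i ∈ S a then 1 else 0

/-- The probability that `q` independent random sets all avoid `i`. -/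
noncomputable def missProb (p : PMF α) (S : α → Finset I) (q : ℕ) (i : I) : ℝ :=
  (1 - inclProb p S i) ^ q

theorem inclProb_mem_Icc (i : I) : inclProb p S i ∈ Set.Icc (0 : ℝ) 1 := by
  refine ⟨mean_nonneg fun a => ?_, (mean_mono fun a => ?_).trans_eq (mean_const p 1)⟩ <;>
    split_ifs <;> simp

theorem mean_missed (q : ℕ) (i : I) :
    mean (iidLaw p q) (fun r => missed S r i) = missProb p S q i := by
  have hcompl : ∀ a, (if i ∈ S a then (0 : ℝ) else 1) = 1 - if i ∈ S a then 1 else 0 :=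
    fun a => by split_ifs <;> simp
  simp only [missed_eq_prod]
  rw [mean_iidLaw_prod p q fun a => if i ∈ S a then (0 : ℝ) else 1]
  simp only [hcompl]
  rw [mean_sub, mean_const, missProb, inclProb]

theorem pow_sub_pow_le_mul {a b d : ℝ} (ha : a ∈ Set.Icc (0 : ℝ) 1) (hb : b ∈ Set.Icc (0 : ℝ) 1)
    (hd : 0 ≤ d) (hab : a - b ≤ d) (q : ℕ) : a ^ q - b ^ q ≤ q * d := by
  induction q with
  | zero => simp
  | succ n ih =>
    have h1 : (a ^ n - b ^ n) * a ≤ n * d :=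
      (mul_le_mul_of_nonneg_right ih ha.1).trans (mul_le_of_le_one_right (by positivity) ha.2)
    have h2 : b ^ n * (a - b) ≤ d :=
      (mul_le_mul_of_nonneg_left hab (pow_nonneg hb.1 n)).trans
        (mul_le_of_le_one_left hd (pow_le_one₀ hb.1 hb.2))
    calc a ^ (n + 1) - b ^ (n + 1) = (a ^ n - b ^ n) * a + b ^ n * (a - b) := by ring
      _ ≤ n * d + d := add_le_add h1 h2
      _ = (n + 1 : ℕ) * d := by push_cast; ring

theorem mean_missed_mul_missed_le (q : ℕ) (i j : I) :
    mean (iidLaw p q) (fun r => missed S r i * missed S r j)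
      ≤ missProb p S q i * missProb p S q j
        + q * mean p fun a => (if i ∈ S a then 1 else 0) * if j ∈ S a then 1 else 0 := by
  set both : ℝ := mean p fun a => (if i ∈ S a then 1 else 0) * if j ∈ S a then 1 else 0
  have hneither : mean p (fun a => (if i ∈ S a then (0 : ℝ) else 1) * if j ∈ S a then 0 else 1)
      = 1 - inclProb p S i - inclProb p S j + both := by
    have hexp : ∀ a, (if i ∈ S a then (0 : ℝ) else 1) * (if j ∈ S a then 0 else 1)
        = 1 - (if i ∈ S a then 1 else 0) - (if j ∈ S a then 1 else 0)
          + (if i ∈ S a then 1 else 0) * if j ∈ S a then 1 else 0 :=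
      fun a => by split_ifs <;> ring
    simp only [hexp]
    rw [mean_add, mean_sub, mean_sub, mean_const, inclProb, inclProb]
  have hneither_mem : mean p (fun a => (if i ∈ S a then (0 : ℝ) else 1) * if j ∈ S a then 0 else 1)
      ∈ Set.Icc (0 : ℝ) 1 :=
    ⟨mean_nonneg fun a => by split_ifs <;> simp,
      (mean_mono fun a => by split_ifs <;> simp).trans_eq (mean_const p 1)⟩
  have hboth : 0 ≤ both := mean_nonneg fun a => by split_ifs <;> simp
  obtain ⟨hi0, hi1⟩ := inclProb_mem_Icc (p := p) (S := S) i
  obtain ⟨hj0, hj1⟩ := inclProb_mem_Icc (p := p) (S := S) j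
  simp only [missed_eq_prod, ← Finset.prod_mul_distrib]
  rw [mean_iidLaw_prod p q fun a => (if i ∈ S a then (0 : ℝ) else 1) * if j ∈ S a then 0 else 1,
    missProb, missProb, ← mul_pow, ← sub_le_iff_le_add']
  refine pow_sub_pow_le_mul hneither_mem
    ⟨mul_nonneg (by linarith) (by linarith), mul_le_one₀ (by linarith) (by linarith) (by linarith)⟩
    hboth ?_ q
  rw [hneither]
  linarith [mul_nonneg hi0 hj0]

theorem mean_sq_sum_mul_missed_le [Fintype I] {u : I → ℝ} {τ : ℝ} (hu : ∀ i, 0 ≤ u i)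
    (hτ : ∀ a, ∑ i ∈ S a, u i ≤ τ) (q : ℕ) :
    mean (iidLaw p q) (fun r => (∑ i, u i * missed S r i) ^ 2)
      ≤ (∑ i, u i * missProb p S q i) ^ 2 + q * τ ^ 2 := by
  refine (mean_sq_sum_le hu (mean_missed_mul_missed_le q)).trans (add_le_add_right ?_ _)
  have hsq : ∀ a, ∑ i, ∑ j, u i * u j * ((if i ∈ S a then 1 else 0) * if j ∈ S a then 1 else 0)
      = (∑ i ∈ S a, u i) ^ 2 := fun a => by
    have hind : ∑ i ∈ S a, u i = ∑ i, u i * if i ∈ S a then 1 else 0 := by simp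
    simp only [hind, sq, Finset.sum_mul_sum, mul_mul_mul_comm]
  calc ∑ i, ∑ j, u i * u j * (q * mean p fun a =>
        (if i ∈ S a then 1 else 0) * if j ∈ S a then 1 else 0)
      = q * mean p fun a => (∑ i ∈ S a, u i) ^ 2 := by
        simp only [← hsq, mean_sum, mean_const_mul, mul_left_comm _ (q : ℝ), ← Finset.mul_sum]
    _ ≤ q * τ ^ 2 := by
        refine mul_le_mul_of_nonneg_left ?_ (Nat.cast_nonneg q)
        refine (mean_mono fun a => ?_).trans_eq (mean_const p _)
        exact pow_le_pow_left₀ (Finset.sum_nonneg fun i _ => hu i) (hτ a) 2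

end Sampling

section Thinning

variable {α I : Type*} [Fintype α] [DecidableEq I] {p : PMF α} {S : α → Finset I} {q : ℕ} {ρ : ℝ}

/-- The weights `z` after sampling `r`: items that were sampled get weight zero, and the others
are rescaled so that every expected weight is multiplied by `ρ`. -/
noncomputable def thin (p : PMF α) (S : α → Finset I) (ρ : ℝ) (z : I → ℝ) (r : Fin q → α) (i : I) :
    ℝ :=
  z i * (ρ / missProb p S q i) * missed S r i

variable (hρ0 : 0 < ρ) (hρ : ∀ i, ρ ≤ missProb p S q i)
include hρ0 hρ

theorem div_missProb_mem_Icc (i : I) : ρ / missProb p S q i ∈ Set.Icc (0 : ℝ) 1 :=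
  ⟨div_nonneg hρ0.le (hρ0.le.trans (hρ i)), (div_le_one (hρ0.trans_le (hρ i))).2 (hρ i)⟩

theorem thin_mem_Icc {z : I → ℝ} (hz : ∀ i, z i ∈ Set.Icc (0 : ℝ) 1) (r : Fin q → α) (i : I) :
    thin p S ρ z r i ∈ Set.Icc (0 : ℝ) 1 := by
  obtain ⟨h1, h2⟩ := div_missProb_mem_Icc hρ0 hρ i
  obtain ⟨h3, h4⟩ := missed_mem_Icc S r i
  obtain ⟨h5, h6⟩ := hz i
  exact ⟨mul_nonneg (mul_nonneg h5 h1) h3, mul_le_one₀ (mul_le_one₀ h6 h1 h2) h3 h4⟩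

theorem mean_thin (z : I → ℝ) (i : I) :
    mean (iidLaw p q) (fun r => thin p S ρ z r i) = ρ * z i := by
  simp only [thin]
  rw [mean_const_mul, mean_missed, mul_assoc, div_mul_cancel₀ _ (hρ0.trans_le (hρ i)).ne', mul_comm]

theorem mean_sq_thin_le [Fintype I] (hρ1 : ρ ≤ 1) {z u : I → ℝ} {τ : ℝ}
    (hz : ∀ i, z i ∈ Set.Icc (0 : ℝ) 1) (hu : ∀ i, 0 ≤ u i) (hτ : ∀ a, ∑ i ∈ S a, u i ≤ τ) (c : ℝ) :
    mean (iidLaw p q) (fun r => (∑ i, u i * thin p S ρ z r i - ρ * c) ^ 2)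
      ≤ (∑ i, u i * z i - c) ^ 2 + q * τ ^ 2 := by
  set y : I → ℝ := fun i => u i * (z i * (ρ / missProb p S q i)) with hy
  have hf := div_missProb_mem_Icc hρ0 hρ
  have hy0 : ∀ i, 0 ≤ y i := fun i => mul_nonneg (hu i) (mul_nonneg (hz i).1 (hf i).1)
  have hyu : ∀ i, y i ≤ u i := fun i =>
    mul_le_of_le_one_right (hu i) (mul_le_one₀ (hz i).2 (hf i).1 (hf i).2)
  have hsum : ∀ r : Fin q → α, ∑ i, u i * thin p S ρ z r i = ∑ i, y i * missed S r i := fun r =>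
    Finset.sum_congr rfl fun i _ => by simp only [thin, hy, mul_assoc]
  have hmean : mean (iidLaw p q) (fun r => ∑ i, y i * missed S r i) = ρ * ∑ i, u i * z i := by
    simp only [← hsum, mean_sum, mean_const_mul, mean_thin hρ0 hρ, Finset.mul_sum, mul_left_comm]
  have hsecond : mean (iidLaw p q) (fun r => (∑ i, y i * missed S r i) ^ 2)
      ≤ mean (iidLaw p q) (fun r => ∑ i, y i * missed S r i) ^ 2 + q * τ ^ 2 := by
    rw [mean_sum]
    simp only [mean_const_mul, mean_missed]
    exact mean_sq_sum_mul_missed_le hy0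
      (fun a => (Finset.sum_le_sum fun i _ => hyu i).trans (hτ a)) q
  simp only [hsum]
  refine (mean_sq_sub_le hsecond (ρ * c)).trans (add_le_add_left ?_ _)
  rw [hmean, ← mul_sub, mul_pow]
  exact mul_le_of_le_one_left (sq_nonneg _) (pow_le_one₀ hρ0.le hρ1)

end Thinning

section Coins

variable {I : Type*} [Fintype I] [DecidableEq I] {z : I → ℝ}

/-- The probability that independent coins with success probabilities `z` select exactly `T`. -/
noncomputable def coinProb (z : I → ℝ) (T : Finset I) : ℝ :=
  (∏ i ∈ T, z i) * ∏ i ∈ Finset.univ \ T, (1 - z i)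

theorem coinProb_nonneg (hz : ∀ i, z i ∈ Set.Icc (0 : ℝ) 1) (T : Finset I) : 0 ≤ coinProb z T :=
  mul_nonneg (Finset.prod_nonneg fun i _ => (hz i).1)
    (Finset.prod_nonneg fun i _ => sub_nonneg.2 (hz i).2)

theorem sum_coinProb_mul_subset (z : I → ℝ) (A : Finset I) :
    ∑ T, coinProb z T * (if A ⊆ T then 1 else 0) = ∏ i ∈ A, z i := by
  have hprod : ∏ i, (z i + if i ∈ A then 0 else 1 - z i) = ∏ i ∈ A, z i := by
    rw [← Finset.prod_subset (Finset.subset_univ A)]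
    · exact Finset.prod_congr rfl fun i hi => by rw [if_pos hi, add_zero]
    · intro i _ hi
      rw [if_neg hi, add_sub_cancel]
  rw [← hprod, Finset.prod_add, Finset.powerset_univ]
  refine Finset.sum_congr rfl fun T _ => ?_
  rw [coinProb, mul_assoc]
  congr 1
  split_ifs with hA
  · rw [mul_one]
    exact Finset.prod_congr rfl fun i hi =>
      (if_neg fun hiA => (Finset.mem_sdiff.1 hi).2 (hA hiA)).symm
  · obtain ⟨i, hiA, hiT⟩ := Finset.not_subset.1 hA
    rw [mul_zero]
    symm
    exact Finset.prod_eq_zero (Finset.mem_sdiff.2 ⟨Finset.mem_univ i, hiT⟩) (if_pos hiA)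

/-- The law of the random set that contains each `i` independently with probability `z i`. -/
noncomputable def coinLaw (z : I → ℝ) (hz : ∀ i, z i ∈ Set.Icc (0 : ℝ) 1) : PMF (Finset I) :=
  PMF.ofFintype (fun T => ENNReal.ofReal (coinProb z T)) (by
    rw [← ENNReal.ofReal_sum_of_nonneg fun T _ => coinProb_nonneg hz T, ← ENNReal.ofReal_one]
    simpa using congrArg ENNReal.ofReal (sum_coinProb_mul_subset z ∅))

variable {hz : ∀ i, z i ∈ Set.Icc (0 : ℝ) 1}

theorem eq_zero_of_mem_support_coinLaw {T : Finset I} (hT : T ∈ (coinLaw z hz).support) {i : I}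
    (hi : z i = 0) : i ∉ T := by
  intro hiT
  refine (PMF.mem_support_iff _ _).1 hT ?_
  rw [coinLaw, PMF.ofFintype_apply, coinProb, Finset.prod_eq_zero hiT hi, zero_mul,
    ENNReal.ofReal_zero]

theorem mean_coinLaw_subset (A : Finset I) :
    mean (coinLaw z hz) (fun T => if A ⊆ T then 1 else 0) = ∏ i ∈ A, z i := by
  rw [← sum_coinProb_mul_subset z A]
  refine Finset.sum_congr rfl fun T _ => ?_
  rw [coinLaw, PMF.ofFintype_apply, ENNReal.toReal_ofReal (coinProb_nonneg hz T)]

theorem mean_coinLaw_mem (i : I) :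
    mean (coinLaw z hz) (fun T => if i ∈ T then 1 else 0) = z i := by
  simpa using mean_coinLaw_subset (hz := hz) {i}

theorem mean_coinLaw_mem_mul_mem_le (i j : I) :
    mean (coinLaw z hz) (fun T => (if i ∈ T then 1 else 0) * if j ∈ T then 1 else 0)
      ≤ z i * z j + if i = j then 1 else 0 := by
  have hand : ∀ T : Finset I, ((if i ∈ T then (1 : ℝ) else 0) * if j ∈ T then 1 else 0)
      = if {i, j} ⊆ T then 1 else 0 := fun T => by
    simp only [Finset.insert_subset_iff, Finset.singleton_subset_iff, ite_and, ite_mul, one_mul,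
      zero_mul]
  simp only [hand]
  rw [mean_coinLaw_subset]
  split_ifs with hij
  · subst hij
    simp only [Finset.pair_eq_singleton, Finset.prod_singleton]
    linarith [(hz i).2, mul_self_nonneg (z i)]
  · rw [Finset.prod_pair hij, add_zero]

theorem mean_coinLaw_sum (u : I → ℝ) :
    mean (coinLaw z hz) (fun T => ∑ i ∈ T, u i) = ∑ i, u i * z i := by
  have hind : ∀ T : Finset I, ∑ i ∈ T, u i = ∑ i, u i * if i ∈ T then 1 else 0 := fun T => by simp
  simp only [hind, mean_sum, mean_const_mul, mean_coinLaw_mem]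

theorem mean_sq_coinLaw_le {u : I → ℝ} (hu : ∀ i, 0 ≤ u i) (c : ℝ) :
    mean (coinLaw z hz) (fun T => (∑ i ∈ T, u i - c) ^ 2)
      ≤ (∑ i, u i * z i - c) ^ 2 + ∑ i, u i ^ 2 := by
  have hsecond := mean_sq_sum_le hu (mean_coinLaw_mem_mul_mem_le (hz := hz))
  simp only [mul_ite, mul_one, mul_zero, Finset.sum_ite_mem, Finset.univ_inter, Finset.sum_ite_eq,
    Finset.mem_univ, if_true, ← sq, ← mean_coinLaw_sum (hz := hz)] at hsecond
  simpa only [mean_coinLaw_sum] using mean_sq_sub_le hsecond c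

end Coins

section Solutions

variable {I : Type*} {P : CMK I}

theorem isConfig_of_card_le_one {C : Finset I} (hC : C.card ≤ 1) : P.IsConfig C := by
  refine ⟨hC.trans P.k_pos, ?_⟩
  obtain rfl | ⟨i, rfl⟩ : C = ∅ ∨ ∃ i, C = {i} := by
    rw [← Finset.card_eq_zero, ← Finset.card_eq_one]
    omega
  · simp
  · simpa using P.w_le_one i

variable [Fintype I]

theorem toReal_configLaw {x : P.FracSol} (hx : 0 < P.size x) (C : P.Config) :
    (P.configLaw x C).toReal = x C / P.size x := by
  have hsum : ∑' C, (x C : ℝ≥0∞) = ENNReal.ofReal (P.size x) := by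
    rw [tsum_fintype, size, ENNReal.ofReal_sum_of_nonneg fun _ _ => NNReal.coe_nonneg _]
    simp
  have h0 : ¬ ∑' C, (x C : ℝ≥0∞) = 0 := by
    rwa [hsum, ENNReal.ofReal_eq_zero, not_le]
  rw [configLaw, dif_neg h0, PMF.normalize_apply, ENNReal.toReal_mul, ENNReal.toReal_inv, hsum,
    ENNReal.toReal_ofReal hx.le, ENNReal.coe_toReal, div_eq_mul_inv]

/-- The factor by which an iteration with the solution `x` and `q` samples scales the expected
weights of the items. -/
noncomputable def retention (P : CMK I) (x : P.FracSol) (q : ℕ) : ℝ := 1 - q / P.size x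

theorem retention_pos {x : P.FracSol} {q : ℕ} (hq : q < P.size x) : 0 < P.retention x q :=
  sub_pos.2 ((div_lt_one ((Nat.cast_nonneg q).trans_lt hq)).2 hq)

theorem retention_le_one (x : P.FracSol) (q : ℕ) : P.retention x q ≤ 1 :=
  sub_le_self _ (div_nonneg (Nat.cast_nonneg _) (Finset.sum_nonneg fun _ _ => NNReal.coe_nonneg _))

variable [DecidableEq I]

theorem inclProb_configLaw {x : P.FracSol} (hx : 0 < P.size x) (i : I) :
    inclProb (P.configLaw x) Subtype.val i = P.cover x i / P.size x := by
  rw [inclProb, mean, cover, Finset.sum_filter, Finset.sum_div]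
  refine Finset.sum_congr rfl fun C _ => ?_
  rw [toReal_configLaw hx, mul_ite, mul_one, mul_zero, ite_div, zero_div]

theorem retention_le_missProb {x : P.FracSol} (hx : 0 < P.size x) {i : I} (hc : P.cover x i ≤ 1)
    (q : ℕ) : P.retention x q ≤ missProb (P.configLaw x) Subtype.val q i := by
  have hincl := inclProb_configLaw hx i
  have hle : inclProb (P.configLaw x) Subtype.val i ≤ 1 := inclProb_mem_Icc i |>.2
  have bernoulli := one_add_mul_le_pow
    (a := -inclProb (P.configLaw x) Subtype.val i) (by linarith) q
  rw [← sub_eq_add_neg] at bernoulli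
  refine le_trans ?_ bernoulli
  rw [retention, hincl, mul_neg, ← sub_eq_add_neg, ← mul_div_assoc]
  gcongr
  exact mul_le_of_le_one_right (Nat.cast_nonneg _) hc

end Solutions

section Survivors

variable {I : Type*} {P : CMK I} {q : ℕ}

theorem packed_snoc [DecidableEq I] {j : ℕ} (h : P.History q j) (r : Fin q → P.Config) :
    P.packed (j := j + 1) (Fin.snoc (α := fun _ => Fin q → P.Config) h r)
      = P.packed h ∪ sampled Subtype.val r := by
  ext i
  simp only [packed, sampled, Finset.mem_union, Finset.mem_biUnion, Finset.mem_univ, true_and,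
    Fin.exists_fin_succ', Fin.snoc_castSucc, Fin.snoc_last]

variable [Fintype I]

theorem sum_sq_le_of_forall_config {u : I → ℝ} {τ b : ℝ} (hu : ∀ i, 0 ≤ u i)
    (hτ : ∀ C : P.Config, ∑ i ∈ C.1, u i ≤ τ) (hb : ∑ i, u i ≤ b * τ) :
    ∑ i, u i ^ 2 ≤ b * τ ^ 2 := by
  have hτ0 : 0 ≤ τ := by simpa [emptyConfig] using hτ P.emptyConfig
  have hle : ∀ i, u i ≤ τ := fun i => by
    simpa using hτ ⟨{i}, isConfig_of_card_le_one (Finset.card_singleton i).le⟩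
  calc ∑ i, u i ^ 2 ≤ ∑ i, τ * u i :=
        Finset.sum_le_sum fun i _ => (sq (u i)).trans_le (mul_le_mul_of_nonneg_right (hle i) (hu i))
    _ = τ * ∑ i, u i := (Finset.mul_sum ..).symm
    _ ≤ τ * (b * τ) := mul_le_mul_of_nonneg_left hb hτ0
    _ = b * τ ^ 2 := by ring

theorem mean_run_succ (X : P.LPRule q) (j : ℕ) (f : P.History q (j + 1) → ℝ) :
    mean (P.run X (j + 1)) f = mean (P.run X j) fun h =>
      mean (iidLaw (P.configLaw (X j h)) q) fun r =>
        f (Fin.snoc (α := fun _ => Fin q → P.Config) h r) := by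
  rw [run, mean_bind]
  simp only [mean_map]

variable [DecidableEq I]

/-- The weights of the items after `j` iterations. Packed items have weight `0`, and the rescaling
of the others keeps the expected weights of all items equal. -/
noncomputable def survivorWeight (X : P.LPRule q) : (j : ℕ) → P.History q j → I → ℝ
  | 0, _ => 1
  | j + 1, h =>
    let past := Fin.init (α := fun _ => Fin q → P.Config) h
    thin (P.configLaw (X j past)) Subtype.val (P.retention (X j past) q)
      (survivorWeight X j past) (h (Fin.last j))

theorem survivorWeight_snoc (X : P.LPRule q) {j : ℕ} (h : P.History q j) (r : Fin q → P.Config) :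
    survivorWeight X (j + 1) (Fin.snoc (α := fun _ => Fin q → P.Config) h r)
      = thin (P.configLaw (X j h)) Subtype.val (P.retention (X j h) q)
        (survivorWeight X j h) r := by
  simp only [survivorWeight, Fin.init_snoc, Fin.snoc_last]

theorem survivorWeight_eq_zero_of_mem_packed (X : P.LPRule q) {j : ℕ} (h : P.History q j) {i : I}
    (hi : i ∈ P.packed h) : survivorWeight X j h i = 0 := by
  induction j with
  | zero => simp [packed] at hi
  | succ j ih =>
    rw [← Fin.snoc_init_self (α := fun _ => Fin q → P.Config) h] at hi ⊢
    rw [survivorWeight_snoc, thin]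
    obtain hi | hi := Finset.mem_union.1 (packed_snoc (P := P) _ _ ▸ hi)
    · rw [ih _ hi, zero_mul, zero_mul]
    · rw [missed, if_pos hi, mul_zero]

/-- The part of `LPRule.IsApprox` on which the survival of the items depends: the solutions chosen
in the first `N` iterations are feasible. -/
def LPRule.IsFeasible (X : P.LPRule q) (ε : ℝ) (N : ℕ) : Prop :=
  ∀ j < N, ∀ h : P.History q j, P.LPFeasible (P.remaining h) (P.m * (1 - j * ε)) (X j h)

theorem LPRule.IsApprox.isFeasible {X : P.LPRule q} {ε : ℝ} {N j : ℕ} (hX : X.IsApprox ε N)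
    (hj : j ≤ N) : X.IsFeasible ε j :=
  fun a ha h => (hX a (ha.trans_le hj) h).1

theorem LPRule.IsFeasible.of_succ {X : P.LPRule q} {ε : ℝ} {j : ℕ}
    (hX : X.IsFeasible ε (j + 1)) : X.IsFeasible ε j :=
  fun a ha => hX a (ha.trans j.lt_succ_self)

section Moments

variable {ε : ℝ} {X : P.LPRule q} {j : ℕ}

theorem lt_size_of_isFeasible (hq : ε * P.m = q) (hX : X.IsFeasible ε (j + 1))
    (hj : (j + 1 : ℕ) * ε < 1) (h : P.History q j) : q < P.size (X j h) := by
  have hm : (0 : ℝ) < P.m := Nat.cast_pos.2 P.m_pos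
  rw [(hX j j.lt_succ_self h).2.2, ← hq, mul_comm ε]
  push_cast at hj
  exact mul_lt_mul_of_pos_left (by linarith) hm

theorem retention_mul_of_isFeasible (hq : ε * P.m = q) (hX : X.IsFeasible ε (j + 1))
    (hj : j * ε < 1) (h : P.History q j) :
    P.retention (X j h) q * (1 - j * ε) = 1 - (j + 1 : ℕ) * ε := by
  have hm : (P.m : ℝ) ≠ 0 := Nat.cast_ne_zero.2 P.m_pos.ne'
  have hjε : 1 - j * ε ≠ 0 := (sub_pos.2 hj).ne'
  rw [retention, (hX j j.lt_succ_self h).2.2, ← hq, mul_comm ε, mul_div_mul_left _ _ hm, sub_mul,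
    one_mul, div_mul_cancel₀ _ hjε]
  push_cast
  ring

variable (hε : 0 < ε) (hq : ε * P.m = q) (hX : X.IsFeasible ε j) (hj : j * ε < 1)
include hε hq hX hj

theorem survivorWeight_mem_Icc (h : P.History q j) (i : I) :
    survivorWeight X j h i ∈ Set.Icc (0 : ℝ) 1 := by
  induction j generalizing i with
  | zero => simp [survivorWeight]
  | succ j ih =>
    have hsize := lt_size_of_isFeasible hq hX hj
    refine thin_mem_Icc (retention_pos (hsize _)) (fun i => retention_le_missProb
      ((Nat.cast_nonneg q).trans_lt (hsize _)) ((hX j j.lt_succ_self _).1 i) q) (fun i => ?_) _ i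
    refine ih hX.of_succ (lt_of_le_of_lt ?_ hj) _ i
    gcongr
    exact j.le_succ

theorem mean_survivorWeight (i : I) :
    mean (P.run X j) (fun h => survivorWeight X j h i) = 1 - j * ε := by
  induction j with
  | zero => simp [survivorWeight, mean_const]
  | succ j ih =>
    have hj' : j * ε < 1 := lt_of_le_of_lt (by gcongr; exact j.le_succ) hj
    have hsize := lt_size_of_isFeasible hq hX hj
    have hret : ∀ h, P.retention (X j h) q = (1 - (j + 1 : ℕ) * ε) / (1 - j * ε) := fun h =>
      eq_div_of_mul_eq (sub_pos.2 hj').ne' (retention_mul_of_isFeasible hq hX hj' h)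
    rw [mean_run_succ]
    simp only [survivorWeight_snoc]
    simp only [mean_thin (retention_pos (hsize _)) fun i => retention_le_missProb
      ((Nat.cast_nonneg q).trans_lt (hsize _)) ((hX j j.lt_succ_self _).1 i) q]
    simp only [hret, mean_const_mul, ih hX.of_succ hj']
    exact div_mul_cancel₀ _ (sub_pos.2 hj').ne'

theorem mean_sq_survivorWeight_le {u : I → ℝ} {τ : ℝ} (hu : ∀ i, 0 ≤ u i)
    (hτ : ∀ C : P.Config, ∑ i ∈ C.1, u i ≤ τ) :
    mean (P.run X j) (fun h => (∑ i, u i * survivorWeight X j h i - (1 - j * ε) * ∑ i, u i) ^ 2)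
      ≤ j * (q * τ ^ 2) := by
  induction j with
  | zero => simp [survivorWeight, mean_const]
  | succ j ih =>
    have hj' : j * ε < 1 := lt_of_le_of_lt (by gcongr; exact j.le_succ) hj
    have hsize := lt_size_of_isFeasible hq hX hj
    rw [mean_run_succ]
    simp only [survivorWeight_snoc]
    calc _ ≤ mean (P.run X j) (fun h =>
          (∑ i, u i * survivorWeight X j h i - (1 - j * ε) * ∑ i, u i) ^ 2 + q * τ ^ 2) := by
          refine mean_mono fun h => ?_
          rw [← retention_mul_of_isFeasible hq hX hj' h, mul_assoc]
          exact mean_sq_thin_le (retention_pos (hsize h)) (fun i => retention_le_missProb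
            ((Nat.cast_nonneg q).trans_lt (hsize h)) ((hX j j.lt_succ_self h).1 i) q)
            (retention_le_one _ _) (survivorWeight_mem_Icc hε hq hX.of_succ hj' h) hu hτ _
      _ ≤ j * (q * τ ^ 2) + q * τ ^ 2 := by
          rw [mean_add, mean_const]
          exact add_le_add_left (ih hX.of_succ hj') _
      _ = (j + 1 : ℕ) * (q * τ ^ 2) := by push_cast; ring

end Moments

/-- The laws `κ h` of a random set of items, one for every history `h` of `j` iterations: the set
avoids the packed items, contains every item with overall probability `1 - j * ε`, and linear
functionals concentrate on it. -/
structure IsSurvivorLaw (X : P.LPRule q) (ε : ℝ) (j : ℕ) (κ : P.History q j → PMF (Finset I)) :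
    Prop where
  subset_remaining : ∀ h, ∀ T ∈ (κ h).support, T ⊆ P.remaining h
  mean_sum : ∀ u : I → ℝ,
    mean (P.run X j) (fun h => mean (κ h) fun T => ∑ i ∈ T, u i) = (1 - j * ε) * ∑ i, u i
  mean_sq_le : ∀ (u : I → ℝ) (τ : ℝ), (∀ i, 0 ≤ u i) → (∀ C : P.Config, ∑ i ∈ C.1, u i ≤ τ) →
    ∑ i, u i ≤ P.m * τ →
    mean (P.run X j) (fun h => mean (κ h) fun T => (∑ i ∈ T, u i - (1 - j * ε) * ∑ i, u i) ^ 2)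
      ≤ 2 * (P.m * τ ^ 2)

theorem exists_isSurvivorLaw {ε : ℝ} {X : P.LPRule q} {j : ℕ} (hε : 0 < ε) (hq : ε * P.m = q)
    (hX : X.IsFeasible ε j) (hj : j * ε < 1) : ∃ κ, IsSurvivorLaw X ε j κ := by
  refine ⟨fun h => coinLaw (survivorWeight X j h) (survivorWeight_mem_Icc hε hq hX hj h),
    fun h T hT i hi => Finset.mem_sdiff.2 ⟨Finset.mem_univ i, fun hp => ?_⟩, fun u => ?_,
    fun u τ hu hτ hm => ?_⟩
  · exact eq_zero_of_mem_support_coinLaw hT (survivorWeight_eq_zero_of_mem_packed X h hp) hi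
  · simp only [mean_coinLaw_sum, mean_sum, mean_const_mul, mean_survivorWeight hε hq hX hj]
    rw [← Finset.sum_mul, mul_comm]
  · have hjq : j * (q * τ ^ 2) ≤ P.m * τ ^ 2 := by
      rw [← hq, ← mul_assoc, ← mul_assoc]
      gcongr
      exact mul_le_of_le_one_left (Nat.cast_nonneg _) hj.le
    refine (mean_mono fun h => mean_sq_coinLaw_le hu _).trans ?_
    rw [mean_add, mean_const, two_mul]
    exact add_le_add ((mean_sq_survivorWeight_le hε hq hX hj hu hτ).trans hjq)
      (sum_sq_le_of_forall_config hu hτ hm)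

end Survivors

section Rank

variable {I : Type*}

theorem exists_rank (A : Finset I) (w : I → ℝ) :
    ∃ e : I → ℕ, A.image e = Finset.range A.card ∧ ∀ i ∈ A, ∀ j ∈ A, e i < e j → w j ≤ w i := by
  classical
  induction A using Finset.induction_on_min_value w with
  | empty => exact ⟨fun _ => 0, by simp, by simp⟩
  | insert a A ha hw ih =>
    obtain ⟨e, he, hanti⟩ := ih
    have hlt : ∀ i ∈ A, e i < A.card := fun i hi =>
      Finset.mem_range.1 (he ▸ Finset.mem_image_of_mem e hi)
    have hne : ∀ i ∈ A, i ≠ a := fun i hi h => ha (h ▸ hi)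
    refine ⟨Function.update e a A.card, ?_, ?_⟩
    · rw [Finset.image_insert, Function.update_self, Finset.card_insert_of_notMem ha,
        Finset.range_add_one, ← he]
      congr 1
      exact Finset.image_congr fun i hi => Function.update_of_ne (hne i hi) _ _
    · intro i hi j hj hij
      rcases Finset.mem_insert.1 hi with rfl | hiA <;> rcases Finset.mem_insert.1 hj with rfl | hjA
      · exact le_rfl
      · rw [Function.update_self, Function.update_of_ne (hne j hjA)] at hij
        exact absurd hij (hlt j hjA).not_gt
      · exact hw i hiA
      · rw [Function.update_of_ne (hne i hiA), Function.update_of_ne (hne j hjA)] at hij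
        exact hanti i hiA j hjA hij

/-- The position of an item of `A`, counted from `0`, when `A` is enumerated by decreasing weight.
Ties are broken arbitrarily, and the rank of an item outside `A` has no meaning. -/
noncomputable def rank (A : Finset I) (w : I → ℝ) : I → ℕ := (exists_rank A w).choose

/-- The `t`-th block of `A`, when the items are grouped by rank into blocks of `s` items, the
heaviest items coming first. -/
noncomputable def block (A : Finset I) (w : I → ℝ) (s t : ℕ) : Finset I :=
  A.filter fun i => rank A w i / s = t

/-- The weight of the heaviest item of the block `t + 1`, and `0` if that block is empty: it
separates the weights in the block `t` from those in the block `t + 1`. -/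
noncomputable def threshold (A : Finset I) (w : I → ℝ) (s t : ℕ) : ℝ :=
  sSup (w '' block A w s (t + 1))

variable {A : Finset I} {w : I → ℝ} {s t : ℕ} {i j : I}

theorem image_rank (A : Finset I) (w : I → ℝ) : A.image (rank A w) = Finset.range A.card :=
  (exists_rank A w).choose_spec.1

theorem le_of_rank_lt (hi : i ∈ A) (hj : j ∈ A) (hij : rank A w i < rank A w j) : w j ≤ w i :=
  (exists_rank A w).choose_spec.2 i hi j hj hij

theorem injOn_rank (A : Finset I) (w : I → ℝ) : Set.InjOn (rank A w) A := by
  rw [← Finset.card_image_iff, image_rank, Finset.card_range]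

theorem rank_lt_card (hi : i ∈ A) : rank A w i < A.card :=
  Finset.mem_range.1 (image_rank A w ▸ Finset.mem_image_of_mem _ hi)

theorem mem_block : i ∈ block A w s t ↔ i ∈ A ∧ rank A w i / s = t := Finset.mem_filter

theorem block_subset : block A w s t ⊆ A := Finset.filter_subset _ _

theorem mem_block_self (hi : i ∈ A) : i ∈ block A w s (rank A w i / s) := mem_block.2 ⟨hi, rfl⟩

theorem pairwiseDisjoint_block (A : Finset I) (w : I → ℝ) (s : ℕ) (T : Set ℕ) :
    T.PairwiseDisjoint (block A w s) := fun _ _ _ _ htu =>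
  Finset.disjoint_left.2 fun _ hi hi' => htu ((mem_block.1 hi).2.symm.trans (mem_block.1 hi').2)

theorem rank_div_lt {K : ℕ} (hs : 0 < s) (hK : A.card ≤ K * s) (hi : i ∈ A) :
    rank A w i / s < K :=
  (Nat.div_lt_iff_lt_mul hs).2 ((rank_lt_card hi).trans_le hK)

theorem le_of_mem_block_succ (hi : i ∈ block A w s t) (hj : j ∈ block A w s (t + 1)) :
    w j ≤ w i := by
  rw [mem_block] at hi hj
  exact le_of_rank_lt hi.1 hj.1 (Nat.lt_of_div_lt_div (c := s) (by omega))

theorem card_block_le (hs : 0 < s) (t : ℕ) : (block A w s t).card ≤ s := by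
  have hinj : Set.InjOn (fun i => rank A w i % s) (block A w s t) := by
    intro i hi j hj hij
    have hi := mem_block.1 hi
    have hj := mem_block.1 hj
    refine injOn_rank A w hi.1 hj.1 ?_
    rw [← Nat.div_add_mod (rank A w i) s, ← Nat.div_add_mod (rank A w j) s, hi.2, hj.2,
      show rank A w i % s = rank A w j % s from hij]
  simpa using Finset.card_le_card_of_injOn (t := Finset.range s) _
    (fun i _ => Finset.mem_coe.2 (Finset.mem_range.2 (Nat.mod_lt _ hs))) hinj

theorem card_block_of_mem_block_succ (hs : 0 < s) (hj : j ∈ block A w s (t + 1)) :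
    (block A w s t).card = s := by
  refine (card_block_le hs t).antisymm ?_
  have hj := mem_block.1 hj
  have hsub : (Finset.range s).image (s * t + ·) ⊆ (block A w s t).image (rank A w) := by
    simp only [Finset.image_subset_iff, Finset.mem_range]
    intro x hx
    have hrank : s * t + x ∈ A.image (rank A w) := by
      have h1 : s * (t + 1) ≤ rank A w j := hj.2 ▸ Nat.mul_div_le _ _
      have h2 := rank_lt_card (w := w) hj.1
      rw [image_rank, Finset.mem_range]
      rw [mul_add, mul_one] at h1
      omega
    obtain ⟨i, hi, hie⟩ := Finset.mem_image.1 hrank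
    refine Finset.mem_image.2 ⟨i, mem_block.2 ⟨hi, ?_⟩, hie⟩
    rw [hie, Nat.mul_add_div hs, Nat.div_eq_of_lt hx, add_zero]
  simpa [Finset.card_image_of_injective _ (add_right_injective _)] using
    (Finset.card_le_card hsub).trans Finset.card_image_le

theorem card_block_succ_le (hs : 0 < s) (t : ℕ) :
    (block A w s (t + 1)).card ≤ (block A w s t).card := by
  rcases (block A w s (t + 1)).eq_empty_or_nonempty with h0 | ⟨j, hj⟩
  · simp [h0]
  · rw [card_block_of_mem_block_succ hs hj]
    exact card_block_le hs _

theorem mul_weight_le_sum_block (hs : 0 < s) (hj : j ∈ block A w s (t + 1)) :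
    s * w j ≤ ∑ i ∈ block A w s t, w i := by
  have h := Finset.card_nsmul_le_sum _ _ _ fun i (hi : i ∈ block A w s t) =>
    le_of_mem_block_succ hi hj
  rwa [card_block_of_mem_block_succ hs hj, nsmul_eq_mul] at h

theorem threshold_nonneg (hw : ∀ i, 0 ≤ w i) : 0 ≤ threshold A w s t :=
  Real.sSup_nonneg (Set.forall_mem_image.2 fun i _ => hw i)

theorem threshold_le (hw : ∀ i, 0 ≤ w i) (hi : i ∈ block A w s t) : threshold A w s t ≤ w i :=
  Real.sSup_le (Set.forall_mem_image.2 fun _ hj => le_of_mem_block_succ hi hj) (hw i)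

theorem le_threshold (hi : i ∈ block A w s (t + 1)) : w i ≤ threshold A w s t :=
  le_csSup ((block A w s (t + 1)).finite_toSet.image w).bddAbove (Set.mem_image_of_mem w hi)

/-! The items of `A` are distributed to `N` bins in the order of their ranks, round robin: the item
`i` goes to the bin `rank A w i % N`. -/

theorem injOn_rank_div (A : Finset I) (w : I → ℝ) (N b : ℕ) :
    Set.InjOn (fun i => rank A w i / N) {i ∈ A | rank A w i % N = b} := by
  rintro i ⟨hi, hib⟩ j ⟨hj, hjb⟩ hij
  refine injOn_rank A w hi hj ?_
  rw [← Nat.div_add_mod (rank A w i) N, ← Nat.div_add_mod (rank A w j) N, hib, hjb,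
    show rank A w i / N = rank A w j / N from hij]

theorem card_rank_mod_le {N c : ℕ} (hN : 0 < N) (hc : A.card ≤ N * c) (b : ℕ) :
    (A.filter fun i => rank A w i % N = b).card ≤ c := by
  have hinj := injOn_rank_div A w N b
  simpa using Finset.card_le_card_of_injOn (s := A.filter fun i => rank A w i % N = b)
    (t := Finset.range c) (fun i => rank A w i / N) (fun i hi => by
      simpa using rank_div_lt hN (by rwa [mul_comm]) (Finset.mem_filter.1 hi).1)
    (by simpa using hinj)

theorem card_block_rank_mod_le (N t b : ℕ) :
    ((block A w N t).filter fun i => rank A w i % N = b).card ≤ 1 := by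
  refine Finset.card_le_one.2 fun i hi j hj => ?_
  rw [Finset.mem_filter, mem_block] at hi hj
  exact injOn_rank_div A w N b ⟨hi.1.1, hi.2⟩ ⟨hj.1.1, hj.2⟩ (hi.1.2.trans hj.1.2.symm)

variable [DecidableEq I]

/-- Each of the remaining items in a bin is charged to the block before its own. -/
theorem mul_sum_rank_mod_le (hw : ∀ i, 0 ≤ w i) {N : ℕ} (hN : 0 < N) (b : ℕ) :
    N * ∑ i ∈ (A \ block A w N 0).filter (fun i => rank A w i % N = b), w i ≤ ∑ i ∈ A, w i := by
  set F := (A \ block A w N 0).filter fun i => rank A w i % N = b with hF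
  have hmem : ∀ i ∈ F, (i ∈ A ∧ rank A w i % N = b) ∧ rank A w i / N ≠ 0 := by
    intro i hi
    rw [hF, Finset.mem_filter, Finset.mem_sdiff, mem_block] at hi
    exact ⟨⟨hi.1.1, hi.2⟩, fun h => hi.1.2 ⟨hi.1.1, h⟩⟩
  have hdisj : (F : Set I).PairwiseDisjoint fun i => block A w N (rank A w i / N - 1) := by
    intro i hi j hj hij
    have hi := hmem i hi
    have hj := hmem j hj
    exact pairwiseDisjoint_block A w N Set.univ trivial trivial fun h => hij <|
      injOn_rank_div A w N b hi.1 hj.1 <|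
        Nat.sub_one_cancel (Nat.pos_of_ne_zero hi.2) (Nat.pos_of_ne_zero hj.2) h
  calc (N : ℝ) * ∑ i ∈ F, w i = ∑ i ∈ F, (N : ℝ) * w i := Finset.mul_sum _ _ _
    _ ≤ ∑ i ∈ F, ∑ j ∈ block A w N (rank A w i / N - 1), w j := by
        refine Finset.sum_le_sum fun i hi => mul_weight_le_sum_block hN ?_
        obtain ⟨⟨hiA, -⟩, hi0⟩ := hmem i hi
        exact mem_block.2 ⟨hiA, (Nat.sub_one_add_one hi0).symm⟩
    _ = ∑ j ∈ F.biUnion fun i => block A w N (rank A w i / N - 1), w j :=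
        (Finset.sum_biUnion hdisj).symm
    _ ≤ ∑ j ∈ A, w j := Finset.sum_le_sum_of_subset_of_nonneg
        (Finset.biUnion_subset.2 fun _ _ => block_subset) fun j _ _ => hw j

end Rank

section Sparse

variable {I : Type*} [DecidableEq I] {A T : Finset I} {w : I → ℝ} {σ : ℕ} {p d : ℝ}

theorem exists_subset_card_le {α : Type*} [DecidableEq α] (X : Finset α) {y d : ℝ} (hy : 0 ≤ y)
    (hd : 0 ≤ d) (h : (X.card : ℝ) ≤ y + d) :
    ∃ Y ⊆ X, (Y.card : ℝ) ≤ y ∧ ((X \ Y).card : ℝ) ≤ d + 1 := by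
  obtain ⟨Y, hYX, hY⟩ := Finset.exists_subset_card_eq (min_le_left X.card ⌊y⌋₊)
  have hfl := Nat.floor_le hy
  have hlt := Nat.lt_floor_add_one y
  have hmin : (Y.card : ℝ) = min (X.card : ℝ) ⌊y⌋₊ := by rw [hY, Nat.cast_min]
  refine ⟨Y, hYX, hmin ▸ (min_le_right _ _).trans hfl, ?_⟩
  rw [Finset.cast_card_sdiff hYX, hmin]
  rcases min_cases (X.card : ℝ) ⌊y⌋₊ with h' | h' <;> linarith [h'.1]

theorem exists_subset_block_succ (hw : ∀ i, 0 ≤ w i) (hσ : 0 < σ) (hp : 0 ≤ p) (hd : 0 ≤ d) {t : ℕ}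
    (hT : ((T ∩ block A w σ (t + 1)).card : ℝ) ≤ p * (block A w σ (t + 1)).card + d) :
    ∃ Y ⊆ T ∩ block A w σ (t + 1), (((T ∩ block A w σ (t + 1)) \ Y).card : ℝ) ≤ d + 1 ∧
      ∑ i ∈ Y, w i ≤ p * ∑ i ∈ block A w σ t, w i := by
  obtain ⟨Y, hYT, hY, hYd⟩ := exists_subset_card_le _ (by positivity) hd hT
  refine ⟨Y, hYT, hYd, ?_⟩
  have hσ' : (0 : ℝ) < σ := Nat.cast_pos.2 hσ
  set W := ∑ i ∈ block A w σ t, w i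
  have hW : 0 ≤ W := Finset.sum_nonneg fun i _ => hw i
  have hcard : (Y.card : ℝ) ≤ p * σ :=
    hY.trans (by gcongr; exact_mod_cast card_block_le hσ (t + 1))
  refine le_of_mul_le_mul_left ?_ hσ'
  calc (σ : ℝ) * ∑ i ∈ Y, w i ≤ Y.card * W := by
        rw [Finset.mul_sum, ← nsmul_eq_mul]
        exact Finset.sum_le_card_nsmul _ _ _ fun j hj =>
          mul_weight_le_sum_block hσ (Finset.mem_inter.1 (hYT hj)).2
    _ ≤ p * σ * W := by gcongr
    _ = σ * (p * W) := by ring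

theorem sdiff_biUnion_subset_block (hσ : 0 < σ) {K : ℕ} (hK : A.card ≤ K * σ)
    (Y : ℕ → Finset I) :
    (T ∩ A) \ (Finset.range K).biUnion Y ⊆ block A w σ 0 ∪
      (Finset.range K).biUnion fun t => (T ∩ block A w σ (t + 1)) \ Y t := by
  intro i hi
  obtain ⟨hiTA, hiY⟩ := Finset.mem_sdiff.1 hi
  obtain ⟨hiT, hiA⟩ := Finset.mem_inter.1 hiTA
  have hiK := rank_div_lt (w := w) hσ hK hiA
  have hib := mem_block_self (w := w) (s := σ) hiA
  rcases hr : rank A w i / σ with _ | t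
  · exact Finset.mem_union_left _ (hr ▸ hib)
  · have ht : t ∈ Finset.range K := Finset.mem_range.2 (by omega)
    exact Finset.mem_union_right _ (Finset.mem_biUnion.2 ⟨t, ht, Finset.mem_sdiff.2
      ⟨Finset.mem_inter.2 ⟨hiT, hr ▸ hib⟩, fun h => hiY (Finset.mem_biUnion.2 ⟨t, ht, h⟩)⟩⟩)

/-- If `T` takes about a fraction `p` of every block of `A`, then a few items can be removed from
`T ∩ A` such that the remaining ones take at most a fraction `p` of the weight of `A`: the items of
each block are paid for by the next heavier block. -/
theorem exists_sparse_subset (hw : ∀ i, 0 ≤ w i) (hσ : 0 < σ) {K : ℕ} (hK : A.card ≤ K * σ)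
    (hp : 0 ≤ p) (hd : 0 ≤ d)
    (hT : ∀ t < K, ((T ∩ block A w σ t).card : ℝ) ≤ p * (block A w σ t).card + d) :
    ∃ U ⊆ T ∩ A, (((T ∩ A) \ U).card : ℝ) ≤ σ + K * (d + 1) ∧
      ∑ i ∈ U, w i ≤ p * ∑ i ∈ A, w i := by
  have hT' : ∀ t, ((T ∩ block A w σ t).card : ℝ) ≤ p * (block A w σ t).card + d := by
    intro t
    rcases (T ∩ block A w σ t).eq_empty_or_nonempty with h0 | ⟨i, hi⟩
    · rw [h0, Finset.card_empty, Nat.cast_zero]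
      positivity
    · have hi := mem_block.1 (Finset.mem_inter.1 hi).2
      exact hT t (hi.2 ▸ rank_div_lt hσ hK hi.1)
  choose Y hYT hYd hYw using fun t => exists_subset_block_succ hw hσ hp hd (hT' (t + 1))
  refine ⟨(Finset.range K).biUnion Y, Finset.biUnion_subset.2 fun t _ =>
    (hYT t).trans (Finset.inter_subset_inter_left block_subset), ?_, ?_⟩
  · have hcard := (Finset.card_le_card
      (sdiff_biUnion_subset_block (T := T) (w := w) hσ hK Y)).trans
      ((Finset.card_union_le _ _).trans
        (add_le_add (card_block_le hσ 0) Finset.card_biUnion_le))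
    calc (((T ∩ A) \ (Finset.range K).biUnion Y).card : ℝ)
        ≤ σ + ∑ t ∈ Finset.range K, (((T ∩ block A w σ (t + 1)) \ Y t).card : ℝ) := by
          exact_mod_cast hcard
      _ ≤ σ + ∑ _t ∈ Finset.range K, (d + 1) := by gcongr with t; exact hYd t
      _ = σ + K * (d + 1) := by rw [Finset.sum_const, Finset.card_range, nsmul_eq_mul]
  · have hdisj : (Finset.range K : Set ℕ).PairwiseDisjoint Y := fun t _ u _ htu =>
      (pairwiseDisjoint_block A w σ Set.univ trivial trivial (by simpa using htu)).mono
        ((hYT t).trans Finset.inter_subset_right) ((hYT u).trans Finset.inter_subset_right)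
    calc ∑ i ∈ (Finset.range K).biUnion Y, w i = ∑ t ∈ Finset.range K, ∑ i ∈ Y t, w i :=
          Finset.sum_biUnion hdisj
      _ ≤ ∑ t ∈ Finset.range K, p * ∑ i ∈ block A w σ t, w i :=
          Finset.sum_le_sum fun t _ => hYw t
      _ = p * ∑ i ∈ A, w i := by
          rw [← Finset.mul_sum]
          congr 1
          exact Finset.sum_fiberwise_of_maps_to
            (fun i hi => Finset.mem_range.2 (rank_div_lt hσ hK hi)) w

theorem exists_distribution {γ : Type*} (A : Finset I) (S : Finset γ) {cap : γ → ℕ} {d : ℝ}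
    (hd : 0 ≤ d) (hA : (A.card : ℝ) ≤ ∑ c ∈ S, (cap c : ℝ) + d) :
    ∃ F : γ → Finset I, (∀ c, F c ⊆ A) ∧ (∀ c, (F c).card ≤ cap c) ∧
      ((A \ S.biUnion F).card : ℝ) ≤ d := by
  classical
  induction S using Finset.induction_on generalizing d with
  | empty => exact ⟨fun _ => ∅, by simpa using hA⟩
  | insert a S ha ih =>
    obtain ⟨F, hFA, hFcap, hFd⟩ := ih (d := cap a + d) (by positivity) (by
      rw [Finset.sum_insert ha] at hA
      linarith)
    set X := A \ S.biUnion F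
    obtain ⟨Y, hYX, hY⟩ := Finset.exists_subset_card_eq (min_le_left X.card (cap a))
    have hupd : ∀ c ∈ S, Function.update F a Y c = F c := fun c hc =>
      Function.update_of_ne (ne_of_mem_of_not_mem hc ha) _ _
    refine ⟨Function.update F a Y, fun c => ?_, fun c => ?_, ?_⟩
    · rcases eq_or_ne c a with rfl | hc
      · simpa using hYX.trans Finset.sdiff_subset
      · simpa [hc] using hFA c
    · rcases eq_or_ne c a with rfl | hc
      · simp [hY]
      · simpa [hc] using hFcap c
    · rw [Finset.biUnion_insert, Function.update_self, Finset.biUnion_congr rfl hupd,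
        Finset.union_comm, ← Finset.sup_eq_union, ← sdiff_sdiff_left, Finset.cast_card_sdiff hYX,
        hY, Nat.cast_min]
      rcases min_cases (X.card : ℝ) (cap a) with h | h <;> linarith [h.1]

end Sparse

section Packing

variable {I : Type*} {P : CMK I}

theorem IsConfig.mono {C D : Finset I} (hD : P.IsConfig D) (h : C ⊆ D) : P.IsConfig C :=
  ⟨(Finset.card_le_card h).trans hD.1,
    (Finset.sum_le_sum_of_subset_of_nonneg h fun i _ _ => P.w_nonneg i).trans hD.2⟩

variable [DecidableEq I]

theorem sum_union_le {u : I → ℝ} (hu : ∀ i, 0 ≤ u i) (A B : Finset I) :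
    ∑ i ∈ A ∪ B, u i ≤ ∑ i ∈ A, u i + ∑ i ∈ B, u i := by
  rw [← Finset.sum_union_inter]
  exact le_add_of_nonneg_right (Finset.sum_nonneg fun i _ => hu i)

theorem sum_biUnion_le {γ : Type*} {u : I → ℝ} (hu : ∀ i, 0 ≤ u i) (S : Finset γ)
    (A : γ → Finset I) : ∑ i ∈ S.biUnion A, u i ≤ ∑ c ∈ S, ∑ i ∈ A c, u i := by
  classical
  induction S using Finset.induction_on with
  | empty => simp
  | insert a S ha ih =>
    rw [Finset.biUnion_insert, Finset.sum_insert ha]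
    exact (sum_union_le hu _ _).trans (add_le_add_right ih _)

theorem card_biUnion_le_mul {γ : Type*} (S : Finset γ) {A : γ → Finset I} {d : ℝ}
    (hA : ∀ c ∈ S, ((A c).card : ℝ) ≤ d) : ((S.biUnion A).card : ℝ) ≤ S.card * d := by
  rw [← nsmul_eq_mul]
  exact (Nat.cast_le.2 Finset.card_biUnion_le).trans
    ((Nat.cast_sum _ _).trans_le (Finset.sum_le_card_nsmul _ _ _ hA))

/-- The items of `T` fit into `n` bins: `n` configurations cover them. Asking for a cover rather
than for a partition is no restriction, as subsets of configurations are configurations. -/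
def Packs (P : CMK I) (T : Finset I) (n : ℕ) : Prop :=
  ∃ S : Finset P.Config, S.card ≤ n ∧ T ⊆ S.biUnion Subtype.val

namespace Packs

variable {T T' : Finset I} {n n' : ℕ}

theorem mono (h : P.Packs T n) (hT : T' ⊆ T) (hn : n ≤ n') : P.Packs T' n' := by
  obtain ⟨S, hSn, hTS⟩ := h
  exact ⟨S, hSn.trans hn, hT.trans hTS⟩

theorem of_forall_isConfig {F : ℕ → Finset I} (hF : ∀ b, P.IsConfig (F b))
    (hT : ∀ i ∈ T, ∃ b < n, i ∈ F b) : P.Packs T n := by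
  refine ⟨(Finset.range n).image fun b => ⟨F b, hF b⟩,
    Finset.card_image_le.trans_eq (Finset.card_range n), fun i hi => ?_⟩
  obtain ⟨b, hb, hib⟩ := hT i hi
  exact Finset.mem_biUnion.2 ⟨_, Finset.mem_image_of_mem _ (Finset.mem_range.2 hb), hib⟩

theorem biUnion {γ : Type*} (S : Finset γ) {T : γ → Finset I} {n : γ → ℕ}
    (h : ∀ c ∈ S, P.Packs (T c) (n c)) : P.Packs (S.biUnion T) (∑ c ∈ S, n c) := by
  choose! F hFn hTF using h
  refine ⟨S.biUnion F, Finset.card_biUnion_le.trans (Finset.sum_le_sum hFn), ?_⟩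
  rw [Finset.biUnion_biUnion]
  exact Finset.biUnion_mono hTF

theorem union (h : P.Packs T n) (h' : P.Packs T' n') : P.Packs (T ∪ T') (n + n') := by
  obtain ⟨S, hSn, hTS⟩ := h
  obtain ⟨S', hSn', hTS'⟩ := h'
  refine ⟨S ∪ S', (Finset.card_union_le _ _).trans (add_le_add hSn hSn'), ?_⟩
  rw [Finset.union_biUnion]
  exact Finset.union_subset_union hTS hTS'

end Packs

theorem packs_card (T : Finset I) : P.Packs T T.card := by
  refine ⟨T.image fun i => ⟨{i}, isConfig_of_card_le_one (Finset.card_singleton i).le⟩,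
    Finset.card_image_le, fun i hi => Finset.mem_biUnion.2 ⟨_, Finset.mem_image_of_mem _ hi, ?_⟩⟩
  exact Finset.mem_singleton_self i

theorem packs_of_weight_le_quarter {Z : Finset I} {N : ℕ} (hN : 0 < N) (hcard : Z.card ≤ N * P.k)
    (hsmall : ∀ i ∈ Z, P.w i ≤ 1 / 4) (hw : ∑ i ∈ Z, P.w i ≤ N * (3 / 4)) : P.Packs Z N := by
  have hN' : (0 : ℝ) < N := Nat.cast_pos.2 hN
  refine .of_forall_isConfig (F := fun b => Z.filter fun i => rank Z P.w i % N = b) (fun b => ?_)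
    fun i hi => ⟨_, Nat.mod_lt _ hN, Finset.mem_filter.2 ⟨hi, rfl⟩⟩
  refine ⟨card_rank_mod_le hN (by linarith) b, ?_⟩
  set D := block Z P.w N 0
  have hrest : ∑ i ∈ (Z \ D).filter (fun i => rank Z P.w i % N = b), P.w i ≤ 3 / 4 :=
    le_of_mul_le_mul_left ((mul_sum_rank_mod_le P.w_nonneg hN b).trans hw) hN'
  have hheavy : ∑ i ∈ D.filter (fun i => rank Z P.w i % N = b), P.w i ≤ 1 / 4 := by
    calc _ ≤ (D.filter fun i => rank Z P.w i % N = b).card • (1 / 4 : ℝ) :=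
          Finset.sum_le_card_nsmul _ _ _ fun i hi =>
            hsmall i (block_subset (Finset.mem_filter.1 hi).1)
      _ ≤ 1 • (1 / 4 : ℝ) :=
          nsmul_le_nsmul_left (by norm_num) (card_block_rank_mod_le N 0 b)
      _ = 1 / 4 := one_nsmul _
  calc _ = ∑ i ∈ (Z \ D).filter (fun i => rank Z P.w i % N = b) ∪
          D.filter (fun i => rank Z P.w i % N = b), P.w i := by
        rw [← Finset.filter_union, Finset.sdiff_union_of_subset block_subset]
    _ ≤ 3 / 4 + 1 / 4 := (sum_union_le P.w_nonneg _ _).trans (add_le_add hrest hheavy)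
    _ = 1 := by norm_num

/-- Bins with `ν t` slots for items of weight at most `θ t` and with room for `κ` further items of
total weight `a`: the slots and the room of `N` such bins can be used up completely, apart from the
`N` heaviest of the further items. -/
theorem packs_slots_union {K N κ : ℕ} (hN : 0 < N) {Q : ℕ → Finset I} {R : Finset I}
    {ν : ℕ → ℕ} {θ : ℕ → ℝ} {a : ℝ} (hθ : ∀ t, 0 ≤ θ t) (hQθ : ∀ t, ∀ i ∈ Q t, P.w i ≤ θ t)
    (hQν : ∀ t, (Q t).card ≤ N * ν t) (hRκ : R.card ≤ N * κ) (hRa : ∑ i ∈ R, P.w i ≤ N * a)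
    (hk : ∑ t ∈ Finset.range K, ν t + κ ≤ P.k)
    (ha : ∑ t ∈ Finset.range K, ν t * θ t + a ≤ 1) :
    P.Packs ((Finset.range K).biUnion Q ∪ (R \ block R P.w N 0)) N := by
  set slot : ℕ → ℕ → Finset I := fun b t => (Q t).filter fun i => rank (Q t) P.w i % N = b
  set rest : ℕ → Finset I := fun b =>
    (R \ block R P.w N 0).filter fun i => rank R P.w i % N = b
  have hslot : ∀ b t, (slot b t).card ≤ ν t := fun b t => card_rank_mod_le hN (hQν t) b
  have hslotw : ∀ b t, ∑ i ∈ slot b t, P.w i ≤ ν t * θ t := fun b t => by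
    calc ∑ i ∈ slot b t, P.w i ≤ (slot b t).card • θ t :=
          Finset.sum_le_card_nsmul _ _ _ fun i hi => hQθ t i (Finset.mem_filter.1 hi).1
      _ ≤ ν t * θ t := by
          rw [nsmul_eq_mul]
          exact mul_le_mul_of_nonneg_right (Nat.cast_le.2 (hslot b t)) (hθ t)
  have hrest : ∀ b, (rest b).card ≤ κ := fun b =>
    (Finset.card_le_card (Finset.filter_subset_filter _ Finset.sdiff_subset)).trans
      (card_rank_mod_le hN hRκ b)
  have hrestw : ∀ b, ∑ i ∈ rest b, P.w i ≤ a := fun b =>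
    le_of_mul_le_mul_left ((mul_sum_rank_mod_le P.w_nonneg hN b).trans hRa) (Nat.cast_pos.2 hN)
  refine .of_forall_isConfig (F := fun b => (Finset.range K).biUnion (slot b) ∪ rest b)
    (fun b => ⟨?_, ?_⟩) fun i hi => ?_
  · exact (Finset.card_union_le _ _).trans ((add_le_add (Finset.card_biUnion_le.trans
      (Finset.sum_le_sum fun t _ => hslot b t)) (hrest b)).trans hk)
  · exact (sum_union_le P.w_nonneg _ _).trans ((add_le_add ((sum_biUnion_le P.w_nonneg _ _).trans
      (Finset.sum_le_sum fun t _ => hslotw b t)) (hrestw b)).trans ha)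
  · rcases Finset.mem_union.1 hi with hi | hi
    · obtain ⟨t, ht, hit⟩ := Finset.mem_biUnion.1 hi
      exact ⟨_, Nat.mod_lt _ hN, Finset.mem_union_left _
        (Finset.mem_biUnion.2 ⟨t, ht, Finset.mem_filter.2 ⟨hit, rfl⟩⟩)⟩
    · exact ⟨_, Nat.mod_lt _ hN, Finset.mem_union_right _ (Finset.mem_filter.2 ⟨hi, rfl⟩)⟩

end Packing

/-- A bound for the number of profiles of bins, in a solution grouped with parameter `s`. -/
def profileBound (s : ℕ) : ℕ := (2 * s ^ 2 + 1) ^ (2 * s ^ 4)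

theorem eight_mul_pow_le_profileBound {s : ℕ} (hs : 2 ≤ s) : 8 * s ^ 8 ≤ profileBound s := by
  have h2 : 4 ≤ s ^ 2 := Nat.pow_le_pow_left hs 2
  have h4 : 16 ≤ s ^ 4 := Nat.pow_le_pow_left hs 4
  calc 8 * s ^ 8 ≤ (2 * s ^ 2 + 1) ^ 4 * (s ^ 2) ^ 4 := by
        rw [← pow_mul]
        have : 8 ^ 4 ≤ (2 * s ^ 2 + 1) ^ 4 := Nat.pow_le_pow_left (by omega) 4
        exact Nat.mul_le_mul_right _ (by omega)
    _ ≤ (2 * s ^ 2 + 1) ^ 4 * (2 * s ^ 2 + 1) ^ 4 :=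
        Nat.mul_le_mul_left _ (Nat.pow_le_pow_left (by omega) 4)
    _ = (2 * s ^ 2 + 1) ^ 8 := (pow_add _ 4 4).symm
    _ ≤ profileBound s := Nat.pow_le_pow_right (by omega) (by omega)

/-- A solution that packs the item `i ∈ items` into the bin `bin i`, with the parameters of a linear
grouping: there are `q * s ^ 2` bins, and the large items are grouped into blocks of `q`. -/
structure GroupedSolution {I : Type*} (P : CMK I) where
  /-- the packed items -/
  items : Finset I
  /-- the bin of a packed item -/
  bin : I → Fin P.m
  /-- the inverse of the precision of the grouping -/
  s : ℕ
  /-- the size of a block of large items -/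
  q : ℕ
  isConfig : ∀ b, P.IsConfig {i ∈ items | bin i = b}
  two_le_s : 2 ≤ s
  profileBound_pow_le : profileBound s ^ 4 ≤ q
  m_eq : P.m = q * s ^ 2

namespace GroupedSolution

section Structure

variable {I : Type*} {P : CMK I} (G : GroupedSolution P)

/-- The items of weight more than `s ^ (-2)`. If the cardinality bound is less than `2 * s ^ 2`,
then all items are regarded as large: in either case a bin holds at most `2 * s ^ 2` large items. -/
noncomputable def large : Finset I := {i ∈ G.items | P.k < 2 * G.s ^ 2 ∨ 1 / (G.s : ℝ) ^ 2 < P.w i}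

/-- The items that are not large. -/
noncomputable def small : Finset I := {i ∈ G.items | 2 * G.s ^ 2 ≤ P.k ∧ P.w i ≤ 1 / (G.s : ℝ) ^ 2}

/-- The blocks of the linear grouping of the large items. -/
noncomputable def largeBlock (t : ℕ) : Finset I := block G.large P.w G.q t

/-- A bound for the number of blocks of large items. -/
def numBlocks : ℕ := 2 * G.s ^ 4

/-- The profile of a bin: the number of its items in each block of large items. -/
noncomputable def profile (b : Fin P.m) (t : ℕ) : ℕ := {i ∈ G.largeBlock t | G.bin i = b}.card

open Classical in
/-- The profiles of the bins. -/
noncomputable def profiles : Finset (ℕ → ℕ) := Finset.univ.image G.profile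

open Classical in
/-- The bins with a given profile. -/
noncomputable def bins (c : ℕ → ℕ) : Finset (Fin P.m) := {b | G.profile b = c}

open Classical in
/-- The small items in the bins with a given profile. -/
noncomputable def smallIn (c : ℕ → ℕ) : Finset I := {i ∈ G.small | G.profile (G.bin i) = c}

/-- The number of large items in a bin with the profile `c`. -/
def slots (c : ℕ → ℕ) : ℕ := ∑ t ∈ Finset.range G.numBlocks, c t

/-- The room for small items in a bin with the profile `c`, when each of its large items has been
replaced by an item of the next block. -/
noncomputable def room (c : ℕ → ℕ) : ℝ :=
  1 - ∑ t ∈ Finset.range G.numBlocks, c t * threshold G.large P.w G.q t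

variable {G} {c : ℕ → ℕ} {b : Fin P.m} {i : I}

theorem s_pos : 0 < G.s := zero_lt_two.trans_le G.two_le_s

theorem q_pos : 0 < G.q := Nat.pos_of_mul_pos_right (G.m_eq ▸ P.m_pos)

theorem mem_profiles : c ∈ G.profiles ↔ ∃ b, G.profile b = c := by simp [profiles]

theorem mem_bins : b ∈ G.bins c ↔ G.profile b = c := by simp [bins]

theorem mem_smallIn : i ∈ G.smallIn c ↔ i ∈ G.small ∧ G.profile (G.bin i) = c := by
  simp [smallIn]

theorem smallIn_subset : G.smallIn c ⊆ G.small := fun _ hi => (mem_smallIn.1 hi).1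

theorem mem_large_or_mem_small (hi : i ∈ G.items) : i ∈ G.large ∨ i ∈ G.small := by
  simp only [large, small, Finset.mem_filter, hi, true_and]
  rcases lt_or_ge P.k (2 * G.s ^ 2) with h | h
  · exact .inl (.inl h)
  · rcases lt_or_ge (1 / (G.s : ℝ) ^ 2) (P.w i) with h' | h'
    exacts [.inl (.inr h'), .inr ⟨h, h'⟩]

theorem disjoint_large_small : Disjoint G.large G.small := by
  refine Finset.disjoint_filter.2 fun i _ hl hs => ?_
  rcases hl with h | h
  exacts [h.not_ge hs.1, h.not_ge hs.2]

theorem isConfig_large (b : Fin P.m) : P.IsConfig {i ∈ G.large | G.bin i = b} :=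
  (G.isConfig b).mono (Finset.filter_subset_filter _ (Finset.filter_subset _ _))

theorem card_le_sq_of_subset_large (hk : 2 * G.s ^ 2 ≤ P.k) {C : Finset I} (hC : P.IsConfig C)
    (hCL : C ⊆ G.large) : C.card ≤ G.s ^ 2 := by
  have hs : (0 : ℝ) < (G.s : ℝ) ^ 2 := by have := G.s_pos; positivity
  have hw : ∀ i ∈ C, 1 / (G.s : ℝ) ^ 2 ≤ P.w i := fun i hi =>
    ((Finset.mem_filter.1 (hCL hi)).2.resolve_left hk.not_gt).le
  have hcard : (C.card : ℝ) * (1 / (G.s : ℝ) ^ 2) ≤ 1 := by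
    rw [← nsmul_eq_mul]
    exact (Finset.card_nsmul_le_sum _ _ _ hw).trans hC.2
  rw [mul_one_div, div_le_one hs] at hcard
  exact_mod_cast hcard

theorem card_le_of_subset_large {C : Finset I} (hC : P.IsConfig C) (hCL : C ⊆ G.large) :
    C.card ≤ 2 * G.s ^ 2 := by
  rcases lt_or_ge P.k (2 * G.s ^ 2) with hk | hk
  · exact hC.1.trans hk.le
  · exact (card_le_sq_of_subset_large hk hC hCL).trans (Nat.le_mul_of_pos_left _ two_pos)

theorem card_large_le : G.large.card ≤ G.numBlocks * G.q := by
  calc G.large.card = ∑ b, {i ∈ G.large | G.bin i = b}.card :=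
        Finset.card_eq_sum_card_fiberwise fun _ _ => Finset.mem_coe.2 (Finset.mem_univ _)
    _ ≤ ∑ _b : Fin P.m, 2 * G.s ^ 2 := Finset.sum_le_sum fun b _ =>
        card_le_of_subset_large (G.isConfig_large b) (Finset.filter_subset _ _)
    _ = G.numBlocks * G.q := by
        rw [Finset.sum_const, Finset.card_univ, Fintype.card_fin, G.m_eq, numBlocks, smul_eq_mul]
        ring

theorem filter_bin_filter_block (b : Fin P.m) (t : ℕ) :
    {i ∈ {i ∈ G.large | G.bin i = b} | rank G.large P.w i / G.q = t} =
      {i ∈ G.largeBlock t | G.bin i = b} := by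
  rw [largeBlock, block, Finset.filter_comm]

theorem slots_profile (b : Fin P.m) :
    G.slots (G.profile b) = {i ∈ G.large | G.bin i = b}.card := by
  rw [Finset.card_eq_sum_card_fiberwise (f := fun i => rank G.large P.w i / G.q)
    (t := Finset.range G.numBlocks)]
  · simp only [filter_bin_filter_block, slots, profile]
  · exact fun i hi => Finset.mem_coe.2 <| Finset.mem_range.2 <|
      rank_div_lt G.q_pos G.card_large_le (Finset.mem_filter.1 hi).1

theorem one_sub_room_profile_le (b : Fin P.m) :
    1 - G.room (G.profile b) ≤ ∑ i ∈ G.large with G.bin i = b, P.w i := by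
  rw [room, sub_sub_cancel, ← Finset.sum_fiberwise_of_maps_to (t := Finset.range G.numBlocks)
    (g := fun i => rank G.large P.w i / G.q) fun i hi => Finset.mem_range.2 <|
      rank_div_lt G.q_pos G.card_large_le (Finset.mem_filter.1 hi).1]
  refine Finset.sum_le_sum fun t _ => ?_
  rw [filter_bin_filter_block, profile, ← nsmul_eq_mul]
  exact Finset.card_nsmul_le_sum _ _ _ fun i hi =>
    threshold_le P.w_nonneg (Finset.mem_filter.1 hi).1

theorem slots_le (hc : c ∈ G.profiles) : G.slots c ≤ P.k := by
  obtain ⟨b, rfl⟩ := mem_profiles.1 hc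
  exact (slots_profile b).trans_le (G.isConfig_large b).1

theorem room_nonneg (hc : c ∈ G.profiles) : 0 ≤ G.room c := by
  obtain ⟨b, rfl⟩ := mem_profiles.1 hc
  linarith [G.one_sub_room_profile_le b, (G.isConfig_large b).2]

theorem le_two_mul_sub_slots (hk : 2 * G.s ^ 2 ≤ P.k) (hc : c ∈ G.profiles) :
    P.k ≤ 2 * (P.k - G.slots c) := by
  obtain ⟨b, rfl⟩ := mem_profiles.1 hc
  have := card_le_sq_of_subset_large hk (G.isConfig_large b) (Finset.filter_subset _ _)
  rw [← slots_profile] at this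
  omega

theorem sum_card_bins : ∑ c ∈ G.profiles, ((G.bins c).card : ℝ) = P.m := by
  classical
  rw [← Nat.cast_sum, Nat.cast_inj]
  exact (Finset.card_eq_sum_card_image G.profile Finset.univ).symm.trans (Finset.card_fin P.m)

theorem card_largeBlock (t : ℕ) :
    (G.largeBlock t).card = ∑ c ∈ G.profiles, (G.bins c).card * c t := by
  classical
  calc (G.largeBlock t).card = ∑ b, G.profile b t :=
        Finset.card_eq_sum_card_fiberwise fun _ _ => Finset.mem_coe.2 (Finset.mem_univ _)
    _ = ∑ c ∈ G.profiles, ∑ b ∈ G.bins c, G.profile b t :=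
        (Finset.sum_fiberwise_of_maps_to
          (fun b _ => Finset.mem_image_of_mem _ (Finset.mem_univ b)) _).symm
    _ = ∑ c ∈ G.profiles, (G.bins c).card * c t := Finset.sum_congr rfl fun c _ =>
        Finset.sum_const_nat fun b hb => by rw [mem_bins.1 hb]

theorem profile_eq_zero {t : ℕ} (ht : G.numBlocks ≤ t) : G.profile b t = 0 := by
  refine Finset.card_eq_zero.2 (Finset.filter_eq_empty_iff.2 fun i hi => ?_)
  have hi := mem_block.1 hi
  exact absurd (hi.2 ▸ rank_div_lt G.q_pos G.card_large_le hi.1) ht.not_gt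

theorem card_profiles_le : G.profiles.card ≤ profileBound G.s := by
  classical
  let restrict : (ℕ → ℕ) → Fin (2 * G.s ^ 4) → ℕ := fun c t => c t
  have hmaps : ∀ c ∈ G.profiles, restrict c ∈
      Fintype.piFinset fun _ : Fin (2 * G.s ^ 4) => Finset.range (2 * G.s ^ 2 + 1) := by
    intro c hc
    obtain ⟨b, rfl⟩ := mem_profiles.1 hc
    exact Fintype.mem_piFinset.2 fun t => Finset.mem_range.2 <| Nat.lt_succ_of_le <|
      card_le_of_subset_large
        ((G.isConfig_large b).mono (Finset.filter_subset_filter _ block_subset))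
        ((Finset.filter_subset _ _).trans block_subset)
  have hinj : Set.InjOn restrict G.profiles := by
    intro c hc c' hc' h
    obtain ⟨b, rfl⟩ := mem_profiles.1 hc
    obtain ⟨b', rfl⟩ := mem_profiles.1 hc'
    ext t
    rcases lt_or_ge t (2 * G.s ^ 4) with ht | ht
    · exact congrFun h ⟨t, ht⟩
    · rw [profile_eq_zero ht, profile_eq_zero ht]
  simpa [profileBound] using Finset.card_le_card_of_injOn restrict hmaps hinj

theorem isConfig_large_union_small [DecidableEq I] (b : Fin P.m) :
    P.IsConfig ({i ∈ G.large | G.bin i = b} ∪ {i ∈ G.small | G.bin i = b}) := by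
  refine (G.isConfig b).mono ?_
  rw [← Finset.filter_union]
  exact Finset.filter_subset_filter _
    (Finset.union_subset (Finset.filter_subset _ _) (Finset.filter_subset _ _))

theorem bin_mem_bins (hi : i ∈ G.smallIn c) : G.bin i ∈ G.bins c :=
  mem_bins.2 (mem_smallIn.1 hi).2

theorem card_smallIn_le (c : ℕ → ℕ) :
    (G.smallIn c).card ≤ (G.bins c).card * (P.k - G.slots c) := by
  classical
  rw [mul_comm]
  refine Finset.card_le_mul_card_image_of_maps_to (f := G.bin)
    (fun _ => bin_mem_bins) _ fun b hb => ?_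
  refine (Finset.card_le_card (Finset.filter_subset_filter _ smallIn_subset)).trans ?_
  have h := (G.isConfig_large_union_small b).1
  rw [Finset.card_union_of_disjoint (Finset.disjoint_filter_filter disjoint_large_small),
    ← slots_profile, mem_bins.1 hb] at h
  omega

theorem weight_smallIn_le (c : ℕ → ℕ) :
    ∑ i ∈ G.smallIn c, P.w i ≤ (G.bins c).card * G.room c := by
  classical
  rw [← Finset.sum_fiberwise_of_maps_to (g := G.bin) (t := G.bins c)
    fun _ => bin_mem_bins, ← nsmul_eq_mul]
  refine Finset.sum_le_card_nsmul _ _ _ fun b hb => ?_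
  have h := (G.isConfig_large_union_small b).2
  rw [Finset.sum_union (Finset.disjoint_filter_filter disjoint_large_small)] at h
  calc ∑ i ∈ G.smallIn c with G.bin i = b, P.w i ≤ ∑ i ∈ G.small with G.bin i = b, P.w i :=
        Finset.sum_le_sum_of_subset_of_nonneg (Finset.filter_subset_filter _ smallIn_subset)
          fun i _ _ => P.w_nonneg i
    _ ≤ G.room (G.profile b) := by linarith [G.one_sub_room_profile_le b]
    _ = G.room c := by rw [mem_bins.1 hb]

end Structure

section Tolerance

variable {I : Type*} {P : CMK I} (G : GroupedSolution P)

/-- The deviation from the mean that is tolerated in a test of a random set of items. -/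
noncomputable def tol : ℝ := P.m / (profileBound G.s : ℝ) ^ 3

/-- A bound for the number of blocks of the small items in the bins of a profile. -/
def numSmallBlocks : ℕ := profileBound G.s * G.s ^ 2

/-- The size of a block of small items. -/
def smallBlockSize : ℕ := P.m * P.k / G.numSmallBlocks + 1

/-- The number of bins reserved for a random set that contains every item with probability `p`,
out of the bins with the profile `c`. -/
noncomputable def binsFor (p : ℝ) (c : ℕ → ℕ) : ℕ :=
  ⌈p * (G.bins c).card + (G.s ^ 2 + 2) * G.tol⌉₊

variable {G}

theorem m_eq_real : (P.m : ℝ) = G.q * (G.s : ℝ) ^ 2 := by exact_mod_cast G.m_eq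

theorem four_le_s_sq : (4 : ℝ) ≤ (G.s : ℝ) ^ 2 := by
  exact_mod_cast Nat.pow_le_pow_left G.two_le_s 2

theorem eight_mul_pow_le : 8 * (G.s : ℝ) ^ 8 ≤ profileBound G.s := by
  exact_mod_cast eight_mul_pow_le_profileBound G.two_le_s

theorem s_pow_le_profileBound {n : ℕ} (hn : n ≤ 8) : (G.s : ℝ) ^ n ≤ profileBound G.s := by
  have h1 : (1 : ℝ) ≤ G.s := Nat.one_le_cast.2 G.s_pos
  linarith [G.eight_mul_pow_le, pow_le_pow_right₀ h1 hn, one_le_pow₀ h1 (n := 8)]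

theorem eight_le_profileBound : (8 : ℝ) ≤ profileBound G.s := by
  have h1 : (1 : ℝ) ≤ G.s := Nat.one_le_cast.2 G.s_pos
  linarith [G.eight_mul_pow_le, one_le_pow₀ h1 (n := 8)]

theorem tol_pos : 0 < G.tol := by
  have h8 := G.eight_le_profileBound
  have hm : (0 : ℝ) < P.m := Nat.cast_pos.2 P.m_pos
  exact div_pos hm (by positivity)

theorem profileBound_mul_tol_le : profileBound G.s * ((G.s : ℝ) ^ 4 * G.tol) ≤ G.q / 8 := by
  have h8 := G.eight_le_profileBound
  rw [tol, G.m_eq_real]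
  set B : ℝ := (profileBound G.s : ℝ)
  have : 0 < B := by linarith
  have h : (G.s : ℝ) ^ 6 / B ^ 2 ≤ 1 / 8 := by
    rw [div_le_div_iff₀ (by positivity) (by norm_num)]
    nlinarith [G.s_pow_le_profileBound (n := 6) (by norm_num)]
  calc B * ((G.s : ℝ) ^ 4 * (G.q * (G.s : ℝ) ^ 2 / B ^ 3)) = G.q * ((G.s : ℝ) ^ 6 / B ^ 2) := by
        field_simp
    _ ≤ G.q * (1 / 8 : ℝ) := by gcongr
    _ = (G.q : ℝ) / 8 := by ring

theorem profileBound_add_le :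
    (profileBound G.s : ℝ) + profileBound G.s ^ 2 * (G.s : ℝ) ^ 2 ≤ G.q / 4 := by
  have h8 := G.eight_le_profileBound
  have hq : (profileBound G.s : ℝ) ^ 4 ≤ G.q := by exact_mod_cast G.profileBound_pow_le
  set B : ℝ := (profileBound G.s : ℝ)
  have h1 : B ≤ B ^ 3 := le_self_pow₀ (by linarith) (by norm_num)
  have h2 : B ^ 2 * (G.s : ℝ) ^ 2 ≤ B ^ 3 := by
    calc B ^ 2 * (G.s : ℝ) ^ 2 ≤ B ^ 2 * B := by
          gcongr
          exact G.s_pow_le_profileBound (by norm_num)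
      _ = B ^ 3 := by ring
  have h3 : 8 * B ^ 3 ≤ B ^ 4 := by
    calc 8 * B ^ 3 ≤ B * B ^ 3 := by gcongr
      _ = B ^ 4 := by ring
  linarith

theorem card_profiles_mul_le : G.profiles.card * ((G.s ^ 2 + 2) * G.tol + 1) ≤ G.q := by
  have htol := G.tol_pos
  have hB := G.profileBound_add_le
  have hB0 : (0 : ℝ) ≤ profileBound G.s ^ 2 * (G.s : ℝ) ^ 2 := by positivity
  have hs : (G.s : ℝ) ^ 2 + 2 ≤ 3 * (G.s : ℝ) ^ 4 := by nlinarith [G.four_le_s_sq]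
  calc G.profiles.card * ((G.s ^ 2 + 2) * G.tol + 1)
      ≤ profileBound G.s * (3 * (G.s : ℝ) ^ 4 * G.tol + 1) := by
        gcongr
        exact G.card_profiles_le
    _ = 3 * (profileBound G.s * ((G.s : ℝ) ^ 4 * G.tol)) + profileBound G.s := by ring
    _ ≤ G.q := by linarith [G.profileBound_mul_tol_le, Nat.cast_nonneg (α := ℝ) G.q]

theorem numBlocks_mul_le : G.numBlocks * (2 * (G.s : ℝ) ^ 2 * G.tol) ≤ G.q := by
  have htol := G.tol_pos
  calc G.numBlocks * (2 * (G.s : ℝ) ^ 2 * G.tol)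
      = 4 * ((G.s : ℝ) ^ 2 * ((G.s : ℝ) ^ 4 * G.tol)) := by
        rw [numBlocks]
        push_cast
        ring
    _ ≤ 4 * (profileBound G.s * ((G.s : ℝ) ^ 4 * G.tol)) := by
        gcongr
        exact G.s_pow_le_profileBound (by norm_num)
    _ ≤ G.q := by linarith [G.profileBound_mul_tol_le, Nat.cast_nonneg (α := ℝ) G.q]

theorem smallBlockSize_le : (G.smallBlockSize : ℝ) ≤ G.q * P.k / profileBound G.s + 1 := by
  have h8 := G.eight_le_profileBound
  have hs := G.s_pos
  rw [smallBlockSize, numSmallBlocks]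
  push_cast
  refine add_le_add_left (Nat.cast_div_le.trans_eq ?_) 1
  push_cast
  rw [G.m_eq_real]
  field_simp

theorem numSmallBlocks_mul_le :
    G.numSmallBlocks * (P.k * G.tol + 1) ≤
      G.q * P.k / profileBound G.s + profileBound G.s * (G.s : ℝ) ^ 2 := by
  have h8 := G.eight_le_profileBound
  have h4 := G.s_pow_le_profileBound (n := 4) (by norm_num)
  rw [numSmallBlocks, tol, G.m_eq_real]
  push_cast
  set B : ℝ := (profileBound G.s : ℝ)
  have hB : 0 < B := by linarith
  calc B * (G.s : ℝ) ^ 2 * (P.k * (G.q * (G.s : ℝ) ^ 2 / B ^ 3) + 1)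
      = G.q * P.k / B * ((G.s : ℝ) ^ 4 / B) + B * (G.s : ℝ) ^ 2 := by field_simp
    _ ≤ G.q * P.k / B + B * (G.s : ℝ) ^ 2 := by
        gcongr
        exact mul_le_of_le_one_right (by positivity) ((div_le_one hB).2 h4)

theorem card_profiles_mul_smallBlockSize_le :
    G.profiles.card * (G.smallBlockSize + G.numSmallBlocks * (P.k * G.tol + 1)) ≤
      3 * (P.k * (G.q : ℝ)) := by
  have h8 := G.eight_le_profileBound
  have htol := G.tol_pos
  have hk : (1 : ℝ) ≤ P.k := Nat.one_le_cast.2 P.k_pos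
  have hq : (G.q : ℝ) ≤ P.k * G.q := le_mul_of_one_le_left (Nat.cast_nonneg _) hk
  set B : ℝ := (profileBound G.s : ℝ)
  calc G.profiles.card * (G.smallBlockSize + G.numSmallBlocks * (P.k * G.tol + 1))
      ≤ B * ((G.q * P.k / B + 1) + (G.q * P.k / B + B * (G.s : ℝ) ^ 2)) := by
        gcongr
        · exact Nat.cast_le.2 G.card_profiles_le
        · exact G.smallBlockSize_le
        · exact G.numSmallBlocks_mul_le
    _ = 2 * (P.k * G.q) + (B + B ^ 2 * (G.s : ℝ) ^ 2) := by
        field_simp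
        ring
    _ ≤ 3 * (P.k * (G.q : ℝ)) := by linarith [G.profileBound_add_le]

theorem le_numSmallBlocks_mul_smallBlockSize :
    P.m * P.k ≤ G.numSmallBlocks * G.smallBlockSize := by
  have h8 : 8 ≤ profileBound G.s := by exact_mod_cast G.eight_le_profileBound
  exact (Nat.lt_mul_div_succ _ (Nat.mul_pos (by omega) (pow_pos G.s_pos 2))).le

theorem sum_binsFor_le {p : ℝ} (hp : 0 ≤ p) :
    ((∑ c ∈ G.profiles, G.binsFor p c : ℕ) : ℝ) ≤ p * P.m + G.q := by
  have htol := G.tol_pos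
  calc ((∑ c ∈ G.profiles, G.binsFor p c : ℕ) : ℝ)
      ≤ ∑ c ∈ G.profiles, (p * (G.bins c).card + ((G.s ^ 2 + 2) * G.tol + 1)) := by
        rw [Nat.cast_sum]
        refine Finset.sum_le_sum fun c _ => ?_
        rw [← add_assoc]
        exact (Nat.ceil_lt_add_one (by positivity)).le
    _ = p * P.m + G.profiles.card * ((G.s ^ 2 + 2) * G.tol + 1) := by
        rw [Finset.sum_add_distrib, ← Finset.mul_sum, G.sum_card_bins, Finset.sum_const,
          nsmul_eq_mul]
    _ ≤ p * P.m + G.q := by linarith [G.card_profiles_mul_le]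

theorem sum_binsFor_le_two_mul {p : ℝ} (hp0 : 0 ≤ p) (hp1 : p ≤ 1) :
    ∑ c ∈ G.profiles, G.binsFor p c ≤ 2 * P.m := by
  have hq : G.q ≤ P.m := G.m_eq ▸ Nat.le_mul_of_pos_right _ (pow_pos G.s_pos 2)
  have h : ((∑ c ∈ G.profiles, G.binsFor p c : ℕ) : ℝ) ≤ (2 * P.m : ℕ) := by
    calc _ ≤ p * P.m + G.q := G.sum_binsFor_le hp0
      _ ≤ P.m + P.m :=
        add_le_add (mul_le_of_le_one_left (Nat.cast_nonneg _) hp1) (Nat.cast_le.2 hq)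
      _ = (2 * P.m : ℕ) := by push_cast; ring
  exact_mod_cast h

theorem le_binsFor (p : ℝ) (c : ℕ → ℕ) :
    p * (G.bins c).card + (G.s ^ 2 + 2) * G.tol ≤ G.binsFor p c := Nat.le_ceil _

theorem binsFor_pos {p : ℝ} (hp : 0 ≤ p) (c : ℕ → ℕ) : 0 < G.binsFor p c := by
  have htol := G.tol_pos
  exact Nat.ceil_pos.2 (by positivity)

theorem mul_card_bins_le_binsFor (p : ℝ) (c : ℕ → ℕ) :
    p * (G.bins c).card ≤ G.binsFor p c :=
  (le_add_of_nonneg_right (mul_nonneg (by positivity) G.tol_pos.le)).trans (G.le_binsFor p c)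

end Tolerance

section Typical

variable {I : Type*} [DecidableEq I] {P : CMK I} {G : GroupedSolution P}

theorem packs_bins {c : ℕ → ℕ} (hc : c ∈ G.profiles) {N : ℕ} (hN : 0 < N) {Q : ℕ → Finset I}
    {R : Finset I} (hQ : ∀ t, Q t ⊆ G.largeBlock (t + 1)) (hQcard : ∀ t, (Q t).card ≤ N * c t)
    (hRcard : R.card ≤ N * (P.k - G.slots c)) (hRw : ∑ i ∈ R, P.w i ≤ N * G.room c) :
    P.Packs ((Finset.range G.numBlocks).biUnion Q ∪ (R \ block R P.w N 0)) N :=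
  packs_slots_union hN (fun _ => threshold_nonneg P.w_nonneg) (fun t _ hi => le_threshold (hQ t hi))
    hQcard hRcard hRw (Nat.add_sub_of_le (slots_le hc)).le (add_sub_cancel _ _).le

theorem packs_of_subset_small {D H : Finset I} (hD : D ⊆ G.small) (hH : H ⊆ G.small)
    (hDcard : (D.card : ℝ) ≤ 3 * (P.k * (G.q : ℝ))) (hDw : ∑ i ∈ D, P.w i ≤ G.q)
    (hHcard : H.card ≤ 2 * P.m) : P.Packs (D ∪ H) (4 * G.q) := by
  have hDH := Finset.union_subset hD hH
  rcases (D ∪ H).eq_empty_or_nonempty with h0 | ⟨i, hi⟩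
  · rw [h0]
    exact (packs_card ∅).mono subset_rfl (Nat.zero_le _)
  have hk : 2 * (G.s : ℝ) ^ 2 ≤ P.k := by exact_mod_cast (Finset.mem_filter.1 (hDH hi)).2.1
  have hs := G.four_le_s_sq
  have hH' : (H.card : ℝ) ≤ 2 * (G.q * (G.s : ℝ) ^ 2) := by
    rw [← G.m_eq_real]
    exact_mod_cast hHcard
  refine packs_of_weight_le_quarter (Nat.mul_pos (by norm_num) G.q_pos) ?_ (fun i hi =>
    (Finset.mem_filter.1 (hDH hi)).2.2.trans (one_div_le_one_div_of_le (by norm_num) hs)) ?_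
  · have : ((D ∪ H).card : ℝ) ≤ (4 * G.q : ℕ) * P.k := by
      calc ((D ∪ H).card : ℝ) ≤ D.card + H.card := by exact_mod_cast Finset.card_union_le D H
        _ ≤ 3 * (P.k * (G.q : ℝ)) + G.q * (2 * (G.s : ℝ) ^ 2) := by linarith
        _ ≤ 3 * (P.k * (G.q : ℝ)) + G.q * P.k := by gcongr
        _ = (4 * G.q : ℕ) * P.k := by push_cast; ring
    exact_mod_cast this
  · have hHw : ∑ i ∈ H, P.w i ≤ 2 * G.q := by
      calc ∑ i ∈ H, P.w i ≤ H.card * (1 / (G.s : ℝ) ^ 2) := by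
            rw [← nsmul_eq_mul]
            exact Finset.sum_le_card_nsmul _ _ _ fun i hi => (Finset.mem_filter.1 (hH hi)).2.2
        _ ≤ 2 * (G.q * (G.s : ℝ) ^ 2) * (1 / (G.s : ℝ) ^ 2) := by gcongr
        _ = 2 * G.q := by rw [mul_assoc, mul_assoc, mul_one_div_cancel (by positivity), mul_one]
    push_cast
    linarith [sum_union_le P.w_nonneg D H]

/-- A set of items of the solution that passes the tests for a random set containing every item with
probability `p`: up to the tolerance, it takes at most a fraction `p` of each block of large items,
and of the small items in the bins of each profile, in weight, in number, and in each block. -/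
structure IsTypical (G : GroupedSolution P) (T : Finset I) (p : ℝ) : Prop where
  subset_items : T ⊆ G.items
  card_largeBlock : ∀ t < G.numBlocks,
    ((T ∩ G.largeBlock t).card : ℝ) ≤ p * (G.largeBlock t).card + 2 * (G.s : ℝ) ^ 2 * G.tol
  weight_smallIn : ∀ c ∈ G.profiles,
    ∑ i ∈ T ∩ G.smallIn c, P.w i ≤ p * ∑ i ∈ G.smallIn c, P.w i + G.tol
  card_smallIn : ∀ c ∈ G.profiles,
    ((T ∩ G.smallIn c).card : ℝ) ≤ p * (G.smallIn c).card + P.k * G.tol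
  card_smallBlock : ∀ c ∈ G.profiles, ∀ t < G.numSmallBlocks,
    ((T ∩ block (G.smallIn c) P.w G.smallBlockSize t).card : ℝ) ≤
      p * (block (G.smallIn c) P.w G.smallBlockSize t).card + P.k * G.tol

namespace IsTypical

variable {T : Finset I} {p : ℝ} {c : ℕ → ℕ}

/-- The items of a block of large items go to the slots of the next heavier block. -/
theorem exists_slots (hT : G.IsTypical T p) (hp : 0 ≤ p) (t : ℕ) :
    ∃ Q : (ℕ → ℕ) → Finset I, (∀ c, Q c ⊆ T ∩ G.largeBlock (t + 1)) ∧
      (∀ c, (Q c).card ≤ G.binsFor p c * c t) ∧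
      (((T ∩ G.largeBlock (t + 1)) \ G.profiles.biUnion Q).card : ℝ) ≤
        2 * (G.s : ℝ) ^ 2 * G.tol := by
  have htol := G.tol_pos
  refine exists_distribution _ _ (by positivity) ?_
  rcases (T ∩ G.largeBlock (t + 1)).eq_empty_or_nonempty with h0 | ⟨i, hi⟩
  · rw [h0, Finset.card_empty, Nat.cast_zero]
    positivity
  have ht : t + 1 < G.numBlocks := by
    have hi := mem_block.1 (Finset.mem_inter.1 hi).2
    exact hi.2 ▸ rank_div_lt G.q_pos G.card_large_le hi.1
  refine (hT.card_largeBlock _ ht).trans (add_le_add_left ?_ _)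
  calc p * (G.largeBlock (t + 1)).card ≤ p * (G.largeBlock t).card := by
        exact mul_le_mul_of_nonneg_left (Nat.cast_le.2 (card_block_succ_le G.q_pos t)) hp
    _ = ∑ c ∈ G.profiles, p * (G.bins c).card * c t := by
        rw [G.card_largeBlock, Nat.cast_sum, Finset.mul_sum]
        exact Finset.sum_congr rfl fun c _ => by push_cast; ring
    _ ≤ ∑ c ∈ G.profiles, ((G.binsFor p c * c t : ℕ) : ℝ) := by
        push_cast
        gcongr with c
        exact G.mul_card_bins_le_binsFor p c

theorem card_inter_smallIn_le (hT : G.IsTypical T p) (hp : 0 ≤ p) (hc : c ∈ G.profiles) :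
    (T ∩ G.smallIn c).card ≤ G.binsFor p c * (P.k - G.slots c) := by
  rcases (T ∩ G.smallIn c).eq_empty_or_nonempty with h0 | ⟨i, hi⟩
  · simp [h0]
  have htol := G.tol_pos
  have hk : 2 * G.s ^ 2 ≤ P.k :=
    (Finset.mem_filter.1 (G.smallIn_subset (Finset.mem_inter.1 hi).2)).2.1
  set κ := P.k - G.slots c
  have hκ : (P.k : ℝ) ≤ 2 * κ := by exact_mod_cast G.le_two_mul_sub_slots hk hc
  have hcard : ((G.smallIn c).card : ℝ) ≤ (G.bins c).card * κ := by
    exact_mod_cast G.card_smallIn_le c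
  have h : ((T ∩ G.smallIn c).card : ℝ) ≤ G.binsFor p c * κ := by
    calc ((T ∩ G.smallIn c).card : ℝ) ≤ p * ((G.bins c).card * κ) + 2 * κ * G.tol :=
          (hT.card_smallIn c hc).trans (by gcongr)
      _ = (p * (G.bins c).card + 2 * G.tol) * κ := by ring
      _ ≤ (p * (G.bins c).card + (G.s ^ 2 + 2) * G.tol) * κ := by
          gcongr
          exact le_add_of_nonneg_left (by positivity)
      _ ≤ G.binsFor p c * κ := by
          gcongr
          exact G.le_binsFor p c
  exact_mod_cast h

theorem weight_inter_smallIn_le (hT : G.IsTypical T p) (hp : 0 ≤ p) (hc : c ∈ G.profiles)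
    (hroom : 1 / (G.s : ℝ) ^ 2 ≤ G.room c) :
    ∑ i ∈ T ∩ G.smallIn c, P.w i ≤ G.binsFor p c * G.room c := by
  have htol := G.tol_pos
  have hs : (0 : ℝ) < (G.s : ℝ) ^ 2 := by have := G.s_pos; positivity
  have hroom0 := G.room_nonneg hc
  have h1 : 1 ≤ (G.s : ℝ) ^ 2 * G.room c := (div_le_iff₀' hs).1 hroom
  calc ∑ i ∈ T ∩ G.smallIn c, P.w i
      ≤ p * ((G.bins c).card * G.room c) + G.tol * ((G.s : ℝ) ^ 2 * G.room c) := by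
        refine (hT.weight_smallIn c hc).trans (add_le_add ?_ (le_mul_of_one_le_right htol.le h1))
        gcongr
        exact G.weight_smallIn_le c
    _ = (p * (G.bins c).card + G.s ^ 2 * G.tol) * G.room c := by ring
    _ ≤ (p * (G.bins c).card + (G.s ^ 2 + 2) * G.tol) * G.room c := by
        gcongr
        exact le_add_of_nonneg_right zero_le_two
    _ ≤ G.binsFor p c * G.room c := by
        gcongr
        exact G.le_binsFor p c

/-- Unless the room for small items is almost used up, the bins that are reserved offer enough
room. Otherwise a few items have to be removed, but these are light. -/
theorem exists_fitting_subset (hT : G.IsTypical T p) (hp : 0 ≤ p) (hc : c ∈ G.profiles) :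
    ∃ R ⊆ T ∩ G.smallIn c, R.card ≤ G.binsFor p c * (P.k - G.slots c) ∧
      ∑ i ∈ R, P.w i ≤ G.binsFor p c * G.room c ∧
      (((T ∩ G.smallIn c) \ R).card : ℝ) ≤
        G.smallBlockSize + G.numSmallBlocks * (P.k * G.tol + 1) ∧
      ∑ i ∈ (T ∩ G.smallIn c) \ R, P.w i ≤ (G.bins c).card / (G.s : ℝ) ^ 2 := by
  have htol := G.tol_pos
  have hcard := hT.card_inter_smallIn_le hp hc
  rcases le_or_gt (1 / (G.s : ℝ) ^ 2) (G.room c) with hroom | hroom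
  · refine ⟨_, subset_rfl, hcard, hT.weight_inter_smallIn_le hp hc hroom, ?_, ?_⟩
    · rw [Finset.sdiff_self, Finset.card_empty, Nat.cast_zero]
      positivity
    · rw [Finset.sdiff_self, Finset.sum_empty]
      positivity
  have hblocks : (G.smallIn c).card ≤ G.numSmallBlocks * G.smallBlockSize := by
    have hbins : (G.bins c).card ≤ P.m := (Finset.card_le_univ _).trans_eq (Fintype.card_fin _)
    exact (G.card_smallIn_le c).trans ((Nat.mul_le_mul hbins (Nat.sub_le _ _)).trans
      G.le_numSmallBlocks_mul_smallBlockSize)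
  obtain ⟨R, hRT, hRcard, hRw⟩ := exists_sparse_subset P.w_nonneg (Nat.succ_pos _) hblocks hp
    (by positivity) (hT.card_smallBlock c hc)
  refine ⟨R, hRT, (Finset.card_le_card hRT).trans hcard, ?_, hRcard, ?_⟩
  · have hroom0 := G.room_nonneg hc
    calc ∑ i ∈ R, P.w i ≤ p * ((G.bins c).card * G.room c) :=
          hRw.trans (by gcongr; exact G.weight_smallIn_le c)
      _ = p * (G.bins c).card * G.room c := by ring
      _ ≤ G.binsFor p c * G.room c := by
          gcongr
          exact G.mul_card_bins_le_binsFor p c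
  · calc ∑ i ∈ (T ∩ G.smallIn c) \ R, P.w i ≤ ∑ i ∈ G.smallIn c, P.w i :=
          Finset.sum_le_sum_of_subset_of_nonneg
            (Finset.sdiff_subset.trans Finset.inter_subset_right) fun i _ _ => P.w_nonneg i
      _ ≤ (G.bins c).card * (1 / (G.s : ℝ) ^ 2) :=
          (G.weight_smallIn_le c).trans (by gcongr)
      _ = (G.bins c).card / (G.s : ℝ) ^ 2 := by ring

/-- Apart from the classes of bins, one packs separately the heaviest block of large items, the
large items that find no slot, the removed small items, and the heaviest small items of a class. -/
theorem subset_union (hT : G.IsTypical T p) (Q : ℕ → (ℕ → ℕ) → Finset I)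
    (R H : (ℕ → ℕ) → Finset I) :
    T ⊆ T ∩ G.largeBlock 0 ∪ (Finset.range G.numBlocks).biUnion (fun t =>
        (T ∩ G.largeBlock (t + 1)) \ G.profiles.biUnion (Q t)) ∪
      G.profiles.biUnion (fun c => (Finset.range G.numBlocks).biUnion (fun t => Q t c) ∪
        (R c \ H c)) ∪
      (G.profiles.biUnion (fun c => (T ∩ G.smallIn c) \ R c) ∪ G.profiles.biUnion H) := by
  intro i hi
  simp only [Finset.mem_union, Finset.mem_biUnion, Finset.mem_sdiff, Finset.mem_inter,
    Finset.mem_range, hi, true_and]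
  rcases G.mem_large_or_mem_small (hT.subset_items hi) with hl | hs
  · have hlt := rank_div_lt (w := P.w) G.q_pos G.card_large_le hl
    have hmem : i ∈ G.largeBlock (rank G.large P.w i / G.q) := mem_block_self hl
    rcases Nat.eq_zero_or_eq_succ_pred (rank G.large P.w i / G.q) with h0 | ht
    · exact .inl (.inl (.inl (h0 ▸ hmem)))
    · set t := (rank G.large P.w i / G.q).pred
      rw [ht] at hmem hlt
      by_cases hc : ∃ c ∈ G.profiles, i ∈ Q t c
      · obtain ⟨c, hc, hic⟩ := hc
        exact .inl (.inr ⟨c, hc, .inl ⟨t, t.lt_succ_self.trans hlt, hic⟩⟩)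
      · exact .inl (.inl (.inr ⟨t, t.lt_succ_self.trans hlt, hmem, hc⟩))
  · have hc : G.profile (G.bin i) ∈ G.profiles := mem_profiles.2 ⟨_, rfl⟩
    by_cases hR : i ∈ R (G.profile (G.bin i))
    · by_cases hH : i ∈ H (G.profile (G.bin i))
      · exact .inr (.inr ⟨_, hc, hH⟩)
      · exact .inl (.inr ⟨_, hc, .inr ⟨hR, hH⟩⟩)
    · exact .inr (.inl ⟨_, hc, mem_smallIn.2 ⟨hs, rfl⟩, hR⟩)

theorem packs (hT : G.IsTypical T p) (hp0 : 0 ≤ p) (hp1 : p ≤ 1) :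
    ∃ n : ℕ, (n : ℝ) ≤ p * P.m + 7 * G.q ∧ P.Packs T n := by
  choose Q hQ hQcard hQrest using hT.exists_slots hp0
  choose! R hR hRcard hRw hDcard hDw using fun c => hT.exists_fitting_subset (c := c) hp0
  set lost := (Finset.range G.numBlocks).biUnion fun t =>
    (T ∩ G.largeBlock (t + 1)) \ G.profiles.biUnion (Q t)
  set D := G.profiles.biUnion fun c => (T ∩ G.smallIn c) \ R c
  set H := fun c => block (R c) P.w (G.binsFor p c) 0
  have hfirst : ((T ∩ G.largeBlock 0).card : ℝ) ≤ G.q := Nat.cast_le.2 <|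
    (Finset.card_le_card Finset.inter_subset_right).trans (card_block_le G.q_pos 0)
  have hlost : (lost.card : ℝ) ≤ G.q :=
    (card_biUnion_le_mul _ fun t _ => hQrest t).trans <| by
      rw [Finset.card_range]
      exact G.numBlocks_mul_le
  have hclasses := Packs.biUnion G.profiles fun c hc =>
    packs_bins hc (G.binsFor_pos hp0 c) (fun t => (hQ t c).trans Finset.inter_subset_right)
      (fun t => hQcard t c) (hRcard c hc) (hRw c hc)
  have hD : D ⊆ G.small := Finset.biUnion_subset.2 fun c _ =>
    Finset.sdiff_subset.trans (Finset.inter_subset_right.trans smallIn_subset)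
  have hH : G.profiles.biUnion H ⊆ G.small := Finset.biUnion_subset.2 fun c hc =>
    block_subset.trans ((hR c hc).trans (Finset.inter_subset_right.trans smallIn_subset))
  have hDw' : ∑ i ∈ D, P.w i ≤ G.q := (sum_biUnion_le P.w_nonneg _ _).trans <| by
    refine (Finset.sum_le_sum hDw).trans_eq ?_
    have hs := G.four_le_s_sq
    rw [← Finset.sum_div, G.sum_card_bins, G.m_eq_real]
    exact mul_div_cancel_right₀ _ (by positivity)
  have hHcard : (G.profiles.biUnion H).card ≤ ∑ c ∈ G.profiles, G.binsFor p c :=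
    Finset.card_biUnion_le.trans
      (Finset.sum_le_sum fun c _ => card_block_le (G.binsFor_pos hp0 c) 0)
  have hlight := packs_of_subset_small hD hH
    ((card_biUnion_le_mul _ hDcard).trans G.card_profiles_mul_smallBlockSize_le) hDw'
    (hHcard.trans (G.sum_binsFor_le_two_mul hp0 hp1))
  refine ⟨_, ?_, ((((packs_card _).union (packs_card lost)).union hclasses).union hlight).mono
    (hT.subset_union Q R H) le_rfl⟩
  have := G.sum_binsFor_le hp0
  push_cast at this ⊢
  linarith

end IsTypical

end Typical

section Tests

variable {I : Type*} {P : CMK I} (G : GroupedSolution P)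

/-- An index set for the tests of `IsTypical`, one summand for each field. -/
abbrev TestIndex : Type :=
  Fin G.numBlocks ⊕ G.profiles ⊕ G.profiles ⊕ G.profiles × Fin G.numSmallBlocks

/-- The set of items that a test examines. -/
noncomputable def testItems : G.TestIndex → Finset I
  | .inl t => G.largeBlock t
  | .inr (.inl c) => G.smallIn c
  | .inr (.inr (.inl c)) => G.smallIn c
  | .inr (.inr (.inr (c, t))) => block (G.smallIn c) P.w G.smallBlockSize t

/-- The factor with which a test counts an item: its weight or `1`. -/
noncomputable def testWeight : G.TestIndex → I → ℝ
  | .inl _ => 1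
  | .inr (.inl _) => P.w
  | .inr (.inr _) => 1

/-- A bound for the values of a test on configurations. -/
noncomputable def testBound : G.TestIndex → ℝ
  | .inl _ => 2 * (G.s : ℝ) ^ 2
  | .inr (.inl _) => 1
  | .inr (.inr _) => P.k

variable {G}

theorem testItems_subset : ∀ f : G.TestIndex, G.testItems f ⊆ G.items
  | .inl _ => block_subset.trans (Finset.filter_subset _ _)
  | .inr (.inl _) => smallIn_subset.trans (Finset.filter_subset _ _)
  | .inr (.inr (.inl _)) => smallIn_subset.trans (Finset.filter_subset _ _)
  | .inr (.inr (.inr _)) => block_subset.trans (smallIn_subset.trans (Finset.filter_subset _ _))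

theorem testBound_pos : ∀ f : G.TestIndex, 0 < G.testBound f
  | .inl _ => by have := G.s_pos; unfold testBound; positivity
  | .inr (.inl _) => one_pos
  | .inr (.inr _) => Nat.cast_pos.2 P.k_pos

theorem sum_le_of_forall_isConfig [Fintype I] {u : I → ℝ} {τ : ℝ} (hu : ∀ i ∉ G.items, u i = 0)
    (hτ : ∀ C : P.Config, ∑ i ∈ C.1, u i ≤ τ) : ∑ i, u i ≤ P.m * τ := by
  rw [← Finset.sum_subset (Finset.subset_univ G.items) fun i _ hi => hu i hi,
    ← Finset.sum_fiberwise_of_maps_to (g := G.bin) (t := Finset.univ) fun i _ => Finset.mem_univ _]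
  refine (Finset.sum_le_card_nsmul _ _ _ fun b _ => hτ ⟨_, G.isConfig b⟩).trans_eq ?_
  rw [Finset.card_univ, Fintype.card_fin, nsmul_eq_mul]

theorem card_testIndex_le : Fintype.card G.TestIndex ≤ profileBound G.s ^ 3 := by
  have h8 : 8 ≤ profileBound G.s := by exact_mod_cast G.eight_le_profileBound
  have hg := G.card_profiles_le
  have hs := eight_mul_pow_le_profileBound G.two_le_s
  have hs2 : G.s ^ 2 ≤ G.s ^ 8 := Nat.pow_le_pow_right G.s_pos (by norm_num)
  have hs4 : G.s ^ 4 ≤ G.s ^ 8 := Nat.pow_le_pow_right G.s_pos (by norm_num)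
  have hcard : Fintype.card G.TestIndex = 2 * G.s ^ 4 + (G.profiles.card + (G.profiles.card +
      G.profiles.card * (profileBound G.s * G.s ^ 2))) := by
    simp only [TestIndex, Fintype.card_sum, Fintype.card_prod, Fintype.card_fin, Fintype.card_coe]
    rfl
  rw [hcard]
  set B := profileBound G.s
  have h1 : 4 * G.s ^ 2 ≤ B := by omega
  calc 2 * G.s ^ 4 + (G.profiles.card + (G.profiles.card + G.profiles.card * (B * G.s ^ 2)))
      ≤ B + (B + (B + B * (B * G.s ^ 2))) := by gcongr; omega
    _ = 3 * B + B ^ 2 * G.s ^ 2 := by ring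
    _ ≤ B ^ 3 := by
        have h2 : B ^ 2 * (4 * G.s ^ 2) ≤ B ^ 2 * B := Nat.mul_le_mul_left _ h1
        have h3 : B * (8 * 8) ≤ B * (B * B) := by gcongr
        nlinarith

variable [DecidableEq I]

variable (G) in
/-- The linear functional of a test: the weight or the number of the items in `testItems`. -/
noncomputable def test (f : G.TestIndex) (i : I) : ℝ :=
  if i ∈ G.testItems f then G.testWeight f i else 0

theorem test_nonneg (f : G.TestIndex) (i : I) : 0 ≤ G.test f i := by
  unfold test testWeight
  split_ifs
  · split
    exacts [zero_le_one, P.w_nonneg i, zero_le_one]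
  · exact le_rfl

theorem test_eq_zero {f : G.TestIndex} {i : I} (hi : i ∉ G.items) : G.test f i = 0 :=
  if_neg fun h => hi (testItems_subset f h)

theorem sum_test_le {C : Finset I} (hC : P.IsConfig C) (f : G.TestIndex) :
    ∑ i ∈ C, G.test f i ≤ G.testBound f := by
  unfold test
  rw [Finset.sum_ite_mem]
  have hsub : C ∩ G.testItems f ⊆ C := Finset.inter_subset_left
  rcases f with t | c | c | c
  · rw [testWeight, Pi.one_def, Finset.sum_const, nsmul_one]
    have hlarge : C ∩ G.testItems (.inl t) ⊆ G.large := Finset.inter_subset_right.trans block_subset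
    change (_ : ℝ) ≤ 2 * (G.s : ℝ) ^ 2
    exact_mod_cast G.card_le_of_subset_large (hC.mono hsub) hlarge
  · exact (hC.mono hsub).2
  all_goals
    rw [testWeight, Pi.one_def, Finset.sum_const, nsmul_one]
    exact Nat.cast_le.2 (hC.mono hsub).1

variable [Fintype I]

variable (G) in
/-- The sum of the squared deviations of the tests from their expectations for a random set that
contains every item with probability `p`, normalized by the deviations that are tolerated. -/
noncomputable def deviation (p : ℝ) (T : Finset I) : ℝ :=
  ∑ f, (1 / (G.testBound f * G.tol) ^ 2) * (∑ i ∈ T, G.test f i - p * ∑ i, G.test f i) ^ 2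

theorem deviation_nonneg (p : ℝ) (T : Finset I) : 0 ≤ G.deviation p T :=
  Finset.sum_nonneg fun _ _ => by positivity

theorem sum_test_le_of_deviation_lt_one {p : ℝ} {T : Finset I} (hT : G.deviation p T < 1)
    (f : G.TestIndex) :
    ∑ i ∈ T, G.test f i ≤ p * ∑ i, G.test f i + G.testBound f * G.tol := by
  by_contra! hlt
  have hd : 0 < G.testBound f * G.tol := mul_pos (testBound_pos f) G.tol_pos
  refine hT.not_ge (le_trans ?_
    (Finset.single_le_sum (fun _ _ => by positivity) (Finset.mem_univ f)))
  rw [one_div, inv_mul_eq_div, one_le_div (by positivity)]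
  exact pow_le_pow_left₀ hd.le (by linarith) 2

theorem isTypical_of_deviation_lt_one {p : ℝ} {T : Finset I} (hT : G.deviation p T < 1) :
    G.IsTypical (T ∩ G.items) p := by
  have htest (f : G.TestIndex) : ∑ i ∈ T ∩ G.items ∩ G.testItems f, G.testWeight f i ≤
      p * ∑ i ∈ G.testItems f, G.testWeight f i + G.testBound f * G.tol := by
    rw [Finset.inter_assoc, Finset.inter_eq_right.2 (testItems_subset f)]
    simpa only [test, Finset.sum_ite_mem, Finset.univ_inter] using
      sum_test_le_of_deviation_lt_one hT f
  have hcount (A : Finset I) : ∑ i ∈ A, (1 : I → ℝ) i = A.card := by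
    rw [Pi.one_def, Finset.sum_const, nsmul_one]
  refine ⟨Finset.inter_subset_right, fun t ht => ?_, fun c hc => ?_, fun c hc => ?_,
    fun c hc t ht => ?_⟩
  · simpa only [testItems, testWeight, testBound, hcount] using htest (.inl ⟨t, ht⟩)
  · have h := htest (.inr (.inl ⟨c, hc⟩))
    rwa [testBound, one_mul] at h
  · simpa only [testItems, testWeight, testBound, hcount] using htest (.inr (.inr (.inl ⟨c, hc⟩)))
  · simpa only [testItems, testWeight, testBound, hcount] using
      htest (.inr (.inr (.inr (⟨c, hc⟩, ⟨t, ht⟩))))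

theorem mean_deviation_le {q j : ℕ} {X : P.LPRule q} {ε : ℝ} {κ : P.History q j → PMF (Finset I)}
    (hκ : IsSurvivorLaw X ε j κ) (hB : profileBound G.s ^ 10 ≤ G.q) :
    mean (P.run X j) (fun h => mean (κ h) (G.deviation (1 - j * ε))) ≤ 1 / (G.s : ℝ) ^ 2 := by
  have htol := G.tol_pos
  have h8 := G.eight_le_profileBound
  have hs := G.four_le_s_sq
  have hB' : (profileBound G.s : ℝ) ^ 10 ≤ G.q := by exact_mod_cast hB
  have hF : (Fintype.card G.TestIndex : ℝ) ≤ profileBound G.s ^ 3 := by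
    exact_mod_cast G.card_testIndex_le
  have hq : (0 : ℝ) < G.q := Nat.cast_pos.2 G.q_pos
  unfold deviation
  simp only [mean_sum, mean_const_mul]
  calc _ ≤ ∑ f, (1 / (G.testBound f * G.tol) ^ 2) * (2 * (P.m * G.testBound f ^ 2)) := by
        gcongr with f
        exact hκ.mean_sq_le _ _ (test_nonneg f) (fun C => sum_test_le C.2 f)
          (sum_le_of_forall_isConfig (fun i hi => test_eq_zero hi) fun C => sum_test_le C.2 f)
    _ = Fintype.card G.TestIndex * (2 * P.m / G.tol ^ 2) := by
        rw [← nsmul_eq_mul, ← Finset.card_univ]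
        refine Finset.sum_eq_card_nsmul fun f _ => ?_
        have := (testBound_pos f).ne'
        field_simp
    _ ≤ profileBound G.s ^ 3 * (2 * P.m / G.tol ^ 2) := by gcongr
    _ = 2 * profileBound G.s ^ 9 / (G.q * (G.s : ℝ) ^ 2) := by
        rw [tol, G.m_eq_real]
        field_simp
    _ ≤ 1 / (G.s : ℝ) ^ 2 := by
        rw [← div_div]
        gcongr
        rw [div_le_one hq]
        refine le_trans ?_ hB'
        rw [pow_succ' _ 9]
        gcongr
        linarith

end Tests

end GroupedSolution

section Value

variable {I : Type*} {P : CMK I}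

theorem setValue_nonneg (T : Finset I) : 0 ≤ P.setValue T :=
  Finset.sum_nonneg fun i _ => P.v_nonneg i

theorem setValue_mono {T T' : Finset I} (h : T ⊆ T') : P.setValue T ≤ P.setValue T' :=
  Finset.sum_le_sum_of_subset_of_nonneg h fun i _ _ => P.v_nonneg i

variable [DecidableEq I]

theorem opt_nonneg (P : CMK I) : 0 ≤ P.opt :=
  Real.iSup_nonneg fun _ => setValue_nonneg _

variable [Fintype I]

theorem cover_eq_sum_mul (x : P.FracSol) (i : I) :
    P.cover x i = ∑ C, (x C : ℝ) * if i ∈ C.1 then 1 else 0 := by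
  simp only [cover, Finset.sum_filter, mul_ite, mul_one, mul_zero]

theorem fracValue_eq_sum_mul (x : P.FracSol) :
    P.fracValue x = ∑ C, (x C : ℝ) * P.setValue C.1 := by
  simp only [fracValue, cover_eq_sum_mul, Finset.sum_mul]
  rw [Finset.sum_comm]
  refine Finset.sum_congr rfl fun C _ => ?_
  simp only [mul_assoc, ← Finset.mul_sum, ite_mul, one_mul, zero_mul, Finset.sum_ite_mem,
    Finset.univ_inter, setValue]

theorem fracValue_nonneg (x : P.FracSol) : 0 ≤ P.fracValue x := by
  rw [fracValue_eq_sum_mul]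
  exact Finset.sum_nonneg fun C _ => mul_nonneg (x C).coe_nonneg (setValue_nonneg _)

theorem LPFeasible.cover_eq_zero {S : Finset I} {l : ℝ} {x : P.FracSol} (hx : P.LPFeasible S l x)
    {i : I} (hi : i ∉ S) : P.cover x i = 0 := by
  refine Finset.sum_eq_zero fun C hC => ?_
  by_contra h
  exact hi (hx.2.1 C (mt (congrArg NNReal.toReal) h) (Finset.mem_filter.1 hC).2)

end Value

section Packings

variable {I : Type*} [DecidableEq I] {P : CMK I} {T : Finset I} {n : ℕ}

theorem Packs.exists_pairwiseDisjoint (h : P.Packs T n) :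
    ∃ A : Finset P.Config, A.card ≤ n ∧ A.biUnion Subtype.val = T ∧
      (A : Set P.Config).PairwiseDisjoint Subtype.val := by
  classical
  obtain ⟨S, hS, hT⟩ := h
  choose! D hD using fun i (hi : i ∈ T) => Finset.mem_biUnion.1 (hT hi)
  have hsub (C : P.Config) : {i ∈ T | D i = C} ⊆ C.1 := fun i hi => by
    obtain ⟨hiT, rfl⟩ := Finset.mem_filter.1 hi
    exact (hD i hiT).2
  let part (C : P.Config) : P.Config := ⟨{i ∈ T | D i = C}, C.2.mono (hsub C)⟩
  refine ⟨S.image part, Finset.card_image_le.trans hS, ?_, ?_⟩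
  · ext i
    simp only [part, Finset.mem_biUnion, Finset.mem_image, exists_exists_and_eq_and,
      Finset.mem_filter]
    exact ⟨fun ⟨_, _, hi, _⟩ => hi, fun hi => ⟨D i, (hD i hi).1, hi, rfl⟩⟩
  · rw [Finset.coe_image]
    rintro _ ⟨C, -, rfl⟩ _ ⟨C', -, rfl⟩ hne
    refine Finset.disjoint_left.2 fun i hi hi' => hne ?_
    rw [← (Finset.mem_filter.1 hi).2, ← (Finset.mem_filter.1 hi').2]

/-- The fractional solution of size `l` that uses every configuration in `A` to the extent `c`,
and the empty configuration for the rest. -/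
noncomputable def uniformSol (A : Finset P.Config) (c l : ℝ≥0) : P.FracSol :=
  open Classical in
  fun C => (if C ∈ A then c else 0) + if C = P.emptyConfig then l - c * A.card else 0

variable [Fintype I] {A : Finset P.Config} {c l : ℝ≥0}

theorem sum_uniformSol_mul (hl : c * A.card ≤ l) (g : P.Config → ℝ) :
    ∑ C, (uniformSol A c l C : ℝ) * g C
      = c * ∑ C ∈ A, g C + (l - c * A.card) * g P.emptyConfig := by
  classical
  simp only [uniformSol, NNReal.coe_add, add_mul, Finset.sum_add_distrib, apply_ite NNReal.toReal,
    NNReal.coe_zero, NNReal.coe_sub hl, NNReal.coe_mul, NNReal.coe_natCast, ite_mul, zero_mul,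
    Finset.sum_ite_mem, Finset.sum_ite_eq', Finset.univ_inter, Finset.mem_univ, if_true,
    Finset.mul_sum]

theorem lpFeasible_uniformSol {S : Finset I} (hA : (A : Set P.Config).PairwiseDisjoint Subtype.val)
    (hAS : ∀ C ∈ A, C.1 ⊆ S) (hc : c ≤ 1) (hl : c * A.card ≤ l) :
    P.LPFeasible S l (uniformSol A c l) := by
  refine ⟨fun i => ?_, fun C hC => ?_, ?_⟩
  · have hcard : {C ∈ A | i ∈ C.1}.card ≤ 1 := Finset.card_le_one.2 fun C hC C' hC' => by
      rw [Finset.mem_filter] at hC hC'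
      by_contra hne
      exact Finset.disjoint_left.1 (hA hC.1 hC'.1 hne) hC.2 hC'.2
    rw [cover_eq_sum_mul, sum_uniformSol_mul hl]
    simp only [emptyConfig, Finset.notMem_empty, if_false, mul_zero, add_zero, Finset.sum_boole]
    exact mul_le_one₀ hc (Nat.cast_nonneg _) (Nat.cast_le_one.2 hcard)
  · by_cases hCA : C ∈ A
    · exact hAS C hCA
    by_cases hC0 : C = P.emptyConfig
    · exact hC0 ▸ Finset.empty_subset S
    · exact absurd (by simp [uniformSol, hCA, hC0]) hC
  · simpa [size] using sum_uniformSol_mul hl fun _ => 1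

theorem Packs.exists_lpFeasible (h : P.Packs T n) {S : Finset I} (hTS : T ⊆ S) (hc : c ≤ 1)
    (hl : c * n ≤ l) :
    ∃ y : P.FracSol, P.LPFeasible S l y ∧ P.fracValue y = c * P.setValue T := by
  obtain ⟨A, hAn, rfl, hA⟩ := h.exists_pairwiseDisjoint
  have hAl : c * A.card ≤ l := le_trans (by gcongr) hl
  refine ⟨uniformSol A c l, lpFeasible_uniformSol hA
    (fun C hC => (Finset.subset_biUnion_of_mem _ hC).trans hTS) hc hAl, ?_⟩
  rw [fracValue_eq_sum_mul, sum_uniformSol_mul hAl]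
  simp only [setValue, Finset.sum_biUnion hA, emptyConfig, Finset.sum_empty, mul_zero, add_zero]

end Packings

section Gain

theorem mul_one_sub_le_one_sub_pow {t : ℝ} (ht : t ∈ Set.Icc (0 : ℝ) 1) (q : ℕ) :
    q * t * (1 - q * t) ≤ 1 - (1 - t) ^ q := by
  obtain ⟨ht0, ht1⟩ := ht
  have hqt : 0 ≤ q * t := mul_nonneg (Nat.cast_nonneg q) ht0
  have hpow : (1 - t) ^ q * (1 + q * t) ≤ 1 :=
    calc (1 - t) ^ q * (1 + q * t) ≤ (1 - t) ^ q * (1 + t) ^ q := by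
          have := pow_nonneg (sub_nonneg.2 ht1) q
          gcongr
          exact one_add_mul_le_pow (by linarith) q
      _ = ((1 - t) * (1 + t)) ^ q := (mul_pow _ _ _).symm
      _ ≤ 1 := pow_le_one₀ (by nlinarith) (by nlinarith)
  have hinv : (1 - t) ^ q ≤ 1 / (1 + q * t) := by rwa [le_div_iff₀ (by linarith)]
  have : 1 / (1 + q * t) ≤ 1 - q * t * (1 - q * t) := by
    rw [div_le_iff₀ (by linarith)]
    nlinarith [pow_nonneg hqt 3]
  linarith

variable {I : Type*} [DecidableEq I] [Fintype I] {P : CMK I} {q j : ℕ}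

theorem le_one_sub_missProb {x : P.FracSol} (hx : 0 < P.size x) {i : I} (hc : P.cover x i ≤ 1)
    (q : ℕ) :
    q / P.size x * (1 - q / P.size x) * P.cover x i
      ≤ 1 - missProb (P.configLaw x) Subtype.val q i := by
  have hincl := inclProb_configLaw hx i
  have hmem : inclProb (P.configLaw x) Subtype.val i ∈ Set.Icc (0 : ℝ) 1 := inclProb_mem_Icc i
  have hle : inclProb (P.configLaw x) Subtype.val i ≤ 1 / P.size x := by
    rw [hincl]
    gcongr
  calc q / P.size x * (1 - q / P.size x) * P.cover x i
      = q * inclProb (P.configLaw x) Subtype.val i * (1 - q * (1 / P.size x)) := by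
        rw [hincl]
        ring
    _ ≤ q * inclProb (P.configLaw x) Subtype.val i
          * (1 - q * inclProb (P.configLaw x) Subtype.val i) := by
        have := hmem.1
        gcongr
    _ ≤ 1 - missProb (P.configLaw x) Subtype.val q i := mul_one_sub_le_one_sub_pow hmem q

theorem setValue_union_sampled (A : Finset I) (r : Fin q → P.Config) :
    P.setValue (A ∪ sampled Subtype.val r)
      = P.setValue A + ∑ i ∈ Finset.univ \ A, P.v i * (1 - missed Subtype.val r i) := by
  have hnew : sampled Subtype.val r \ A = {i ∈ Finset.univ \ A | i ∈ sampled Subtype.val r} := by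
    ext i
    simp [and_comm]
  rw [← Finset.union_sdiff_self_eq_union, setValue, Finset.sum_union Finset.disjoint_sdiff, hnew,
    Finset.sum_filter, setValue]
  refine congrArg₂ _ rfl (Finset.sum_congr rfl fun i _ => ?_)
  rw [missed]
  split_ifs <;> simp

/-- The expected value of the items packed in the first `j` iterations. -/
noncomputable def meanValue (X : P.LPRule q) (j : ℕ) : ℝ :=
  mean (P.run X j) fun h => P.setValue (P.packed h)

theorem meanValue_nonneg (X : P.LPRule q) (j : ℕ) : 0 ≤ meanValue X j :=
  mean_nonneg fun _ => setValue_nonneg _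

theorem meanValue_mono (X : P.LPRule q) : Monotone (meanValue X) := by
  refine monotone_nat_of_le_succ fun j => ?_
  rw [meanValue, meanValue, mean_run_succ]
  refine mean_mono fun h => ?_
  rw [← mean_const (iidLaw (P.configLaw (X j h)) q) (P.setValue (P.packed h))]
  refine mean_mono fun r => ?_
  rw [packed_snoc]
  exact setValue_mono Finset.subset_union_left

theorem setValue_add_le_mean_setValue {l : ℝ} (hl : 0 < l) {x : P.FracSol}
    (A : Finset I) (hx : P.LPFeasible (Finset.univ \ A) l x) (q : ℕ) :
    P.setValue A + q / l * (1 - q / l) * P.fracValue x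
      ≤ mean (iidLaw (P.configLaw x) q) fun r => P.setValue (A ∪ sampled Subtype.val r) := by
  obtain rfl : P.size x = l := hx.2.2
  simp only [setValue_union_sampled, mean_add, mean_const, mean_sum, mean_const_mul, mean_sub,
    mean_missed]
  refine add_le_add_right ?_ _
  have hfrac : P.fracValue x = ∑ i ∈ Finset.univ \ A, P.cover x i * P.v i :=
    (Finset.sum_subset (Finset.subset_univ _) fun i _ hi => by
      rw [hx.cover_eq_zero hi, zero_mul]).symm
  rw [hfrac, Finset.mul_sum]
  refine Finset.sum_le_sum fun i _ => ?_
  rw [← mul_assoc, mul_comm (P.v i)]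
  exact mul_le_mul_of_nonneg_right (le_one_sub_missProb hl (hx.1 i) q) (P.v_nonneg i)

theorem meanValue_add_le_meanValue_succ {X : P.LPRule q} {l : ℝ} (hl : 0 < l)
    (hX : ∀ h : P.History q j, P.LPFeasible (P.remaining h) l (X j h)) :
    meanValue X j + q / l * (1 - q / l) * mean (P.run X j) (fun h => P.fracValue (X j h))
      ≤ meanValue X (j + 1) := by
  rw [meanValue, meanValue, mean_run_succ, ← mean_const_mul, ← mean_add]
  refine mean_mono fun h => ?_
  simp only [packed_snoc]
  exact setValue_add_le_mean_setValue hl _ (hX h) q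

end Gain

section Optimum

variable {I : Type*}

theorem exists_optimal_assignment [DecidableEq I] [Finite I] (P : CMK I) :
    ∃ (O : Finset I) (bin : I → Fin P.m), (∀ b, P.IsConfig {i ∈ O | bin i = b}) ∧
      P.setValue O = P.opt := by
  have := Fintype.ofFinite I
  obtain ⟨C, hC⟩ := P.opt_isGreatest.1
  have : Nonempty (Fin P.m) := ⟨⟨0, P.m_pos⟩⟩
  choose! bin hbin using fun i (hi : i ∈ Finset.univ.biUnion fun b => (C b).1) =>
    Finset.mem_biUnion.1 hi
  refine ⟨_, bin, fun b => (C b).2.mono fun i hi => ?_, hC⟩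
  obtain ⟨hiO, rfl⟩ := Finset.mem_filter.1 hi
  exact (hbin i hiO).2

theorem exists_groupedSolution [DecidableEq I] [Finite I] {P : CMK I} {s q : ℕ} (hs : 2 ≤ s)
    (hq : profileBound s ^ 4 ≤ q) (hm : P.m = q * s ^ 2) :
    ∃ G : GroupedSolution P, P.setValue G.items = P.opt ∧ G.s = s ∧ G.q = q := by
  obtain ⟨O, bin, hbin, hO⟩ := P.exists_optimal_assignment
  exact ⟨⟨O, bin, s, q, hbin, hs, hq, hm⟩, hO, rfl, rfl⟩

namespace GroupedSolution

variable {P : CMK I} {G : GroupedSolution P} {ε : ℝ}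

theorem mul_m_eq (hε : ε = 1 / (G.s : ℝ) ^ 2) : ε * P.m = G.q := by
  have : (G.s : ℝ) ≠ 0 := Nat.cast_ne_zero.2 G.s_pos.ne'
  rw [hε, G.m_eq_real]
  field_simp

theorem mem_Ioc_of_eq (hε : ε = 1 / (G.s : ℝ) ^ 2) : ε ∈ Set.Ioc 0 1 := by
  have := G.four_le_s_sq
  rw [hε]
  exact ⟨by positivity, (div_le_one (by linarith)).2 (by linarith)⟩

variable [DecidableEq I] [Fintype I]

theorem sub_mul_deviation_le_fracValue (hopt : P.setValue G.items = P.opt)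
    (hε : ε = 1 / (G.s : ℝ) ^ 2) {p : ℝ} (hp : p ∈ Set.Ioc 0 1) {S T : Finset I} (hTS : T ⊆ S)
    {x : P.FracSol} (hx : P.LPApprox ε S (P.m * p) x) :
    (1 - ε) * (p / (p + 7 * ε)) * (P.setValue (T ∩ G.items) - P.opt * G.deviation p T)
      ≤ P.fracValue x := by
  obtain ⟨hε0, hε1⟩ := mem_Ioc_of_eq hε
  obtain ⟨hp0, hp1⟩ := hp
  have hden : 0 < p + 7 * ε := by linarith
  obtain ⟨c, hc⟩ : ∃ c : ℝ, c = p / (p + 7 * ε) := ⟨_, rfl⟩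
  have hc0 : 0 ≤ c := by rw [hc]; positivity
  have : 0 ≤ 1 - ε := sub_nonneg.2 hε1
  rw [← hc]
  rcases lt_or_ge (G.deviation p T) 1 with hT | hT
  · obtain ⟨n, hn, hpack⟩ := (isTypical_of_deviation_lt_one hT).packs hp0.le hp1
    have hcn : c * n ≤ P.m * p :=
      calc c * n ≤ c * (p * P.m + 7 * G.q) := by gcongr
        _ = c * (p + 7 * ε) * P.m := by rw [← mul_m_eq hε]; ring
        _ = P.m * p := by rw [hc, div_mul_cancel₀ _ hden.ne', mul_comm]
    have hmp : 0 ≤ P.m * p := by positivity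
    lift c to ℝ≥0 using hc0
    obtain ⟨y, hy, hyv⟩ := hpack.exists_lpFeasible (c := c) (l := ⟨P.m * p, hmp⟩)
      (Finset.inter_subset_left.trans hTS)
      (by exact_mod_cast hc.trans_le ((div_le_one hden).2 (by linarith))) (by exact_mod_cast hcn)
    refine le_trans ?_ (hx.2 y hy)
    rw [hyv, mul_assoc]
    gcongr
    exact sub_le_self _ (mul_nonneg P.opt_nonneg (deviation_nonneg p T))
  · refine (mul_nonpos_of_nonneg_of_nonpos (by positivity) (sub_nonpos.2 ?_)).trans
      (fracValue_nonneg x)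
    calc P.setValue (T ∩ G.items) ≤ P.opt := hopt ▸ setValue_mono Finset.inter_subset_right
      _ ≤ P.opt * G.deviation p T := le_mul_of_one_le_right P.opt_nonneg hT

theorem le_mean_fracValue (hopt : P.setValue G.items = P.opt) (hB : profileBound G.s ^ 10 ≤ G.q)
    (hε : ε = 1 / (G.s : ℝ) ^ 2) {X : P.LPRule G.q} {N j : ℕ} (hX : X.IsApprox ε N) (hjN : j < N)
    {p : ℝ} (hp : p = 1 - j * ε) (hp0 : 0 < p) :
    (1 - ε) * (p / (p + 7 * ε)) * ((p - ε) * P.opt)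
      ≤ mean (P.run X j) fun h => P.fracValue (X j h) := by
  obtain ⟨hε0, hε1⟩ := mem_Ioc_of_eq hε
  have hp1 : p ≤ 1 := hp.trans_le (sub_le_self _ (by positivity))
  obtain ⟨κ, hκ⟩ := exists_isSurvivorLaw hε0 (mul_m_eq hε) (hX.isFeasible hjN.le) (by linarith)
  have hlp (h : P.History G.q j) : (1 - ε) * (p / (p + 7 * ε)) *
      (mean (κ h) (fun T => P.setValue (T ∩ G.items)) - P.opt * mean (κ h) (G.deviation p))
        ≤ P.fracValue (X j h) := by
    rw [← mean_const_mul, ← mean_sub, ← mean_const_mul]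
    refine (mean_mono_of_mem_support fun T hT => ?_).trans_eq (mean_const (κ h) _)
    exact sub_mul_deviation_le_fracValue hopt hε ⟨hp0, hp1⟩ (hκ.subset_remaining h T hT)
      (hp ▸ hX j hjN h)
  have hvalue : mean (P.run X j) (fun h => mean (κ h) fun T => P.setValue (T ∩ G.items))
      = p * P.opt := by
    have := hκ.mean_sum fun i => if i ∈ G.items then P.v i else 0
    simp only [Finset.sum_ite_mem, Finset.univ_inter] at this
    rw [hp, ← hopt]
    exact this
  have hdev : mean (P.run X j) (fun h => mean (κ h) (G.deviation p)) ≤ ε := by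
    rw [hp, hε]
    exact hε ▸ mean_deviation_le hκ hB
  refine le_trans ?_ (mean_mono hlp)
  rw [mean_const_mul, mean_sub, mean_const_mul, hvalue]
  have : 0 ≤ 1 - ε := sub_nonneg.2 hε1
  gcongr
  linarith [mul_le_mul_of_nonneg_left hdev P.opt_nonneg]

end GroupedSolution

end Optimum

section Iterations

theorem one_sub_le_gain_factor {r s : ℝ} (hs : 1 ≤ s) (hrs : s ≤ r) :
    1 - 10 / s ≤ (1 - 1 / r) ^ 2 * (1 - 1 / s ^ 2) * (r / (r + 7)) := by
  have hs0 : 0 < s := by linarith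
  have hr : 1 / r ≤ 1 / s := one_div_le_one_div_of_le hs0 hrs
  have hss : 1 / s ^ 2 ≤ 1 / s := by
    rw [sq, ← div_div]
    exact div_le_self (by positivity) hs
  have h7 : s / (s + 7) ≤ r / (r + 7) := by
    rw [div_le_div_iff₀ (by linarith) (by linarith)]
    linarith
  have h1 : 0 ≤ 1 - 1 / s := sub_nonneg.2 ((div_le_one hs0).2 hs)
  calc 1 - 10 / s ≤ (1 - 3 * (1 / s)) * (s / (s + 7)) := by
        field_simp
        nlinarith
    _ ≤ (1 - 1 / s) ^ 3 * (s / (s + 7)) := by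
        gcongr
        have := one_add_mul_le_pow (a := -(1 / s)) (by linarith) 3
        norm_num at this ⊢
        linarith
    _ = (1 - 1 / s) ^ 2 * (1 - 1 / s) * (s / (s + 7)) := by ring
    _ ≤ (1 - 1 / r) ^ 2 * (1 - 1 / s ^ 2) * (r / (r + 7)) := by
        gcongr
        exact mul_nonneg (sq_nonneg _) (by linarith)

variable {I : Type*} [DecidableEq I] [Fintype I] {P : CMK I}

theorem meanValue_add_le_of_add_le {G : GroupedSolution P} (hopt : P.setValue G.items = P.opt)
    (hB : profileBound G.s ^ 10 ≤ G.q) {X : P.LPRule G.q}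
    (hX : X.IsApprox (1 / (G.s : ℝ) ^ 2) (G.s ^ 2)) {j : ℕ} (hj : j + G.s ≤ G.s ^ 2) :
    meanValue X j + (1 - 10 / G.s) / (G.s : ℝ) ^ 2 * P.opt ≤ meanValue X (j + 1) := by
  have hs0 : (0 : ℝ) < G.s := Nat.cast_pos.2 G.s_pos
  have hs1 : (1 : ℝ) ≤ G.s := Nat.one_le_cast.2 G.s_pos
  have hq0 : (0 : ℝ) < G.q := Nat.cast_pos.2 G.q_pos
  set s : ℝ := (G.s : ℝ) with hs
  obtain ⟨r, hr⟩ : ∃ r : ℝ, r = s ^ 2 - j := ⟨_, rfl⟩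
  have hrs : s ≤ r := by
    have : (j : ℝ) + G.s ≤ (G.s : ℝ) ^ 2 := by exact_mod_cast hj
    linarith
  have hr0 : 0 < r := hs0.trans_le hrs
  have hp : r / s ^ 2 = 1 - j * (1 / s ^ 2) := by
    rw [hr]
    field_simp
  have hl : (P.m : ℝ) * (1 - j * (1 / s ^ 2)) = G.q * r := by
    rw [← hp, G.m_eq_real, ← hs]
    field_simp
  have hjs : j < G.s ^ 2 := by linarith [G.s_pos]
  have hgain := meanValue_add_le_meanValue_succ (l := G.q * r) (by positivity)
    fun h => hl ▸ (hX j hjs h).1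
  have hlp := G.le_mean_fracValue hopt hB rfl hX hjs hp (by positivity)
  rw [← hs] at hlp
  have hr1 : 0 ≤ 1 - 1 / r := sub_nonneg.2 ((div_le_one hr0).2 (hs1.trans hrs))
  have hqr : (G.q : ℝ) / (G.q * r) = 1 / r := by field_simp
  rw [hqr] at hgain
  calc meanValue X j + (1 - 10 / s) / s ^ 2 * P.opt
      ≤ meanValue X j + (1 - 1 / r) ^ 2 * (1 - 1 / s ^ 2) * (r / (r + 7)) / s ^ 2 * P.opt := by
        have := P.opt_nonneg
        have := one_sub_le_gain_factor hs1 hrs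
        gcongr
    _ = meanValue X j + 1 / r * (1 - 1 / r) * ((1 - 1 / s ^ 2) *
          (r / s ^ 2 / (r / s ^ 2 + 7 * (1 / s ^ 2))) * ((r / s ^ 2 - 1 / s ^ 2) * P.opt)) := by
        field_simp
    _ ≤ meanValue X j + 1 / r * (1 - 1 / r) * mean (P.run X j) fun h => P.fracValue (X j h) := by
        gcongr
    _ ≤ meanValue X (j + 1) := hgain

theorem mul_opt_le_meanValue {G : GroupedSolution P} (hopt : P.setValue G.items = P.opt)
    (hB : profileBound G.s ^ 10 ≤ G.q) {X : P.LPRule G.q}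
    (hX : X.IsApprox (1 / (G.s : ℝ) ^ 2) (G.s ^ 2)) {j : ℕ} (hj : j + G.s ≤ G.s ^ 2 + 1) :
    j * ((1 - 10 / G.s) / (G.s : ℝ) ^ 2 * P.opt) ≤ meanValue X j := by
  induction j with
  | zero =>
    rw [Nat.cast_zero, zero_mul]
    exact meanValue_nonneg X 0
  | succ j ih =>
    push_cast
    linarith [ih (by omega), meanValue_add_le_of_add_le hopt hB hX (j := j) (by omega)]

theorem one_sub_mul_opt_le_meanValue {s q : ℕ} (hs : 2 ≤ s) (hm : P.m = q * s ^ 2)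
    (hB : profileBound s ^ 10 ≤ q) {X : P.LPRule q} (hX : X.IsApprox (1 / (s : ℝ) ^ 2) (s ^ 2)) :
    (1 - 11 / s) * P.opt ≤ meanValue X (s ^ 2) := by
  have hB0 : 0 < profileBound s := by unfold profileBound; positivity
  obtain ⟨G, hopt, rfl, rfl⟩ :=
    exists_groupedSolution hs ((Nat.pow_le_pow_right hB0 (by norm_num)).trans hB) hm
  have : (0 : ℝ) < G.s := Nat.cast_pos.2 G.s_pos
  have hss : G.s ≤ G.s ^ 2 := Nat.le_self_pow (by norm_num) G.s
  calc (1 - 11 / G.s) * P.opt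
      ≤ (1 - 11 / G.s + 10 / (G.s : ℝ) ^ 2) * P.opt := by
        have := P.opt_nonneg
        gcongr
        exact le_add_of_nonneg_right (by positivity)
    _ = (G.s ^ 2 - G.s : ℕ) * ((1 - 10 / G.s) / (G.s : ℝ) ^ 2 * P.opt) := by
        rw [Nat.cast_sub hss]
        push_cast
        field_simp
        ring
    _ ≤ meanValue X (G.s ^ 2 - G.s) := mul_opt_le_meanValue hopt hB hX (by omega)
    _ ≤ meanValue X (G.s ^ 2) := meanValue_mono X (Nat.sub_le _ _)

end Iterations

section Parameters

theorem profileBound_pow_le_exp (s : ℕ) :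
    (profileBound s : ℝ) ^ 11 ≤ Real.exp (44 * (s : ℝ) ^ 6) :=
  calc (profileBound s : ℝ) ^ 11 = (2 * (s : ℝ) ^ 2 + 1) ^ (2 * s ^ 4 * 11) := by
        rw [profileBound]
        push_cast
        rw [← pow_mul]
    _ ≤ Real.exp (2 * (s : ℝ) ^ 2) ^ (2 * s ^ 4 * 11) := by
        gcongr
        exact Real.add_one_le_exp _
    _ = Real.exp (44 * (s : ℝ) ^ 6) := by
        rw [← Real.exp_nat_mul]
        congr 1
        push_cast
        ring

theorem profileBound_pow_le_of_exp_le {s q : ℕ} (hs : 2 ≤ s)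
    (h : Real.exp (44 * (s : ℝ) ^ 6) ≤ q * (s : ℝ) ^ 2) : profileBound s ^ 10 ≤ q := by
  have hB : profileBound s ^ 11 ≤ q * s ^ 2 := by
    exact_mod_cast (profileBound_pow_le_exp s).trans h
  have hsB : s ^ 2 ≤ profileBound s := by
    have : s ^ 2 ≤ s ^ 8 := Nat.pow_le_pow_right (by omega) (by norm_num)
    linarith [eight_mul_pow_le_profileBound hs]
  refine Nat.le_of_mul_le_mul_right (c := s ^ 2) ?_ (by positivity)
  calc profileBound s ^ 10 * s ^ 2 ≤ profileBound s ^ 10 * profileBound s := by gcongr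
    _ ≤ q * s ^ 2 := by rwa [← pow_succ]

theorem exists_eq_one_div_sq {ε : ℝ} (hε : 0 < ε) (h : ∃ s : ℕ, ε ^ (-(1 / 2) : ℝ) = s) :
    ∃ s : ℕ, 0 < s ∧ ε = 1 / (s : ℝ) ^ 2 ∧ ε ^ (1 / 2 : ℝ) = 1 / s := by
  obtain ⟨s, hs⟩ := h
  have hsqrt : ε ^ (1 / 2 : ℝ) = 1 / s := by
    rw [← hs, Real.rpow_neg hε.le, one_div (_⁻¹), inv_inv]
  refine ⟨s, Nat.cast_pos.1 (hs ▸ Real.rpow_pos_of_pos hε _), ?_, hsqrt⟩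
  rw [← one_div_pow, ← hsqrt, ← Real.rpow_natCast, ← Real.rpow_mul hε.le]
  norm_num

theorem numIter_one_div_sq (s : ℕ) : numIter (1 / (s : ℝ) ^ 2) = s ^ 2 := by
  rw [numIter, one_div, inv_inv, ← Nat.cast_pow, Nat.floor_natCast]

variable {I : Type*} {P : CMK I}

theorem m_eq_batch_mul_sq {s : ℕ} (hs : 0 < s) (h : ∃ q : ℕ, 1 / (s : ℝ) ^ 2 * P.m = q) :
    P.m = P.batch (1 / (s : ℝ) ^ 2) * s ^ 2 := by
  obtain ⟨q, hq⟩ := h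
  rw [batch, hq, Nat.floor_natCast]
  have : (P.m : ℝ) = q * (s : ℝ) ^ 2 := by
    rw [← hq]
    field_simp
  exact_mod_cast this

theorem IsSimple.exp_le {ε : ℝ} (hP : P.IsSimple ε) (hε0 : 0 < ε) (hε1 : ε < 0.1) :
    Real.exp (44 * ε ^ (-3 : ℤ)) ≤ P.m := by
  have hinv : 10 ≤ ε⁻¹ := by
    rw [le_inv_comm₀ (by norm_num) hε0]
    linarith
  have hpow : 44 * ε ^ (-3 : ℤ) ≤ ε ^ (-30 : ℤ) := by
    simp only [zpow_neg, zpow_ofNat, ← inv_pow]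
    calc 44 * ε⁻¹ ^ 3 ≤ ε⁻¹ ^ 27 * ε⁻¹ ^ 3 := by
          gcongr
          exact (by norm_num : (44 : ℝ) ≤ 10 ^ 27).trans (by gcongr)
      _ = ε⁻¹ ^ 30 := by ring
  refine le_trans (Real.exp_le_exp.2 ?_) hP.1.le
  linarith [Real.add_one_le_exp (ε ^ (-30 : ℤ))]

end Parameters

end CMK

theorem lemma3p7_general {I : Type*} [Fintype I] [DecidableEq I] (ε : ℝ) (hε0 : 0 < ε)
    (hεs : ∃ s : ℕ, ε ^ (-(1 / 2) : ℝ) = s) (P : CMK I)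
    (hm : Real.exp (44 * ε ^ (-3 : ℤ)) ≤ P.m) (hq : ∃ q : ℕ, ε * P.m = q)
    (X : P.LPRule (P.batch ε)) (hX : X.IsApprox ε (CMK.numIter ε)) :
    (1 - 11 * ε ^ (1 / 2 : ℝ)) * P.opt ≤ P.expectedValue ε X := by
  change _ ≤ CMK.meanValue X (CMK.numIter ε)
  obtain ⟨s, hs0, rfl, hsqrt⟩ := CMK.exists_eq_one_div_sq hε0 hεs
  rw [hsqrt, mul_one_div, CMK.numIter_one_div_sq]
  rw [CMK.numIter_one_div_sq] at hX
  rcases (show 1 ≤ s from hs0).eq_or_lt with rfl | hs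
  · exact (mul_nonpos_of_nonpos_of_nonneg (by norm_num) P.opt_nonneg).trans
      (CMK.meanValue_nonneg X _)
  have hmq := CMK.m_eq_batch_mul_sq hs0 hq
  have hexp : (1 / (s : ℝ) ^ 2) ^ (-3 : ℤ) = (s : ℝ) ^ 6 := by
    rw [one_div, zpow_neg, inv_zpow, inv_inv, zpow_ofNat, ← pow_mul]
  refine CMK.one_sub_mul_opt_le_meanValue hs hmq (CMK.profileBound_pow_le_of_exp_le hs ?_) hX
  exact hexp ▸ hm.trans_eq (by exact_mod_cast hmq)

theorem lemma3p7 {I : Type*} [Fintype I] [DecidableEq I] (ε : ℝ) (hε0 : 0 < ε) (hε1 : ε < 0.1)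
    (hεs : ∃ s : ℕ, ε ^ (-(1 / 2) : ℝ) = s)
    (P : CMK I) (hP : P.IsSimple ε)
    (X : P.LPRule (P.batch ε)) (hX : X.IsApprox ε (CMK.numIter ε)) :
    (1 - 300 * ε ^ (1 / 2 : ℝ)) * P.opt ≤ P.expectedValue ε X := by
  refine le_trans (mul_le_mul_of_nonneg_right ?_ P.opt_nonneg)
    (lemma3p7_general ε hε0 hεs P (hP.exp_le hε0 hε1) hP.2 X hX)
  linarith [Real.rpow_nonneg hε0.le (1 / 2)]
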